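/- For $\alpha\in\mathbb R$ let $f(v,\alpha)=v^3-\alpha v^2-1$ and consider the planar system $$\frac{dv}{d\tau}=v f(v,\alpha)+z^2,\qquad \frac{dz}{d\tau}=z f(v,\alpha). \qquad (*)$$ For $\alpha<-3/\sqrt[3]{4}$ the equation $f(v,\alpha)=0$ has exactly three real roots $v_1^0(\alpha)<v_2^0(\alpha)<0<v_3^0(\alpha)$. Let $L^-(\alpha)$ be the unstable separatrix of the equilibrium $(v_1^0(\alpha),0)$ in the upper half plane, that is, the trajectory of $(*)$ with $z>0$ that tends to $(v_1^0(\alpha),0)$ as $\tau\to-\infty$, and let $L^+(\alpha)$ be the stable separatrix of $(v_3^0(\alpha),0)$ in the upper half plane, that is, the trajectory with $z>0$ that tends to $(v_3^0(\alpha),0)$ as $\tau\to+\infty$. For a point $(v_*,z_*)$ with $z_*>0$ and $v_*f(v_*,\alpha)+z_*^2>0$, follow the trajectory of $(*)$ through it, forwards and backwards, as long as $vf(v,\alpha)+z^2=dv/d\tau>0$; this arc is the graph of a function $z=\phi(v;v_*,z_*,\alpha)$ on an open interval. Let $\phi^-(v;\alpha)=\phi(v;v_*,z_*,\alpha)$ where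 $(v_*,z_*)$ is any point of $L^-(\alpha)$ with $v_1^0(\alpha)<v_*<v_2^0(\alpha)$ and $v_*f(v_*,\alpha)+z_*^2>0$, and let $(v_1^0(\alpha),v^-(\alpha))$ be its interval of definition; if $v^-(\alpha)=0$, put $\phi^-(0;\alpha)=\lim_{v\to0^-}\phi^-(v;\alpha)$. Let $\phi^+(v;\alpha)=\phi(v;v_*,z_*,\alpha)$ where $(v_*,z_*)$ is any point of $L^+(\alpha)$ with $v_2^0(\alpha)\le v_*<v_3^0(\alpha)$ and $v_*f(v_*,\alpha)+z_*^2>0$. Lemma. Let $\alpha_0<-3/\sqrt[3]{4}$. For every $v_0\in(v_1^0(\alpha_0),0]$, the number $\phi^-(v_0;\alpha)$ is well defined (it exists and is unique) for all $\alpha$ in a neighbourhood of $\alpha_0$, and $\alpha\mapsto\phi^-(v_0;\alpha)$ is continuous at $\alpha_0$. For every $v_0\in[0,v_3^0(\alpha_0))$, the number $\phi^+(v_0;\alpha)$ is well defined for all $\alpha$ in a neighbourhood of $\alpha_0$, and $\alpha\mapsto\phi^+(v_0;\alpha)$ is continuous at $\alpha_0$. -/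

import Mathlib

open Filter Topology

noncomputable section

namespace PolySys

/-- The cubic `f(v, α) = v³ - α v² - 1`. -/
def f (v α : ℝ) : ℝ := v ^ 3 - α * v ^ 2 - 1

/-- The smallest real zero of `f(·, α)`. -/
def v1 (α : ℝ) : ℝ := sInf {v : ℝ | f v α = 0}

/-- The second smallest real zero of `f(·, α)`. -/
def v2 (α : ℝ) : ℝ := sInf {v : ℝ | f v α = 0 ∧ v1 α < v}

/-- The third smallest real zero of `f(·, α)`. -/
def v3 (α : ℝ) : ℝ := sInf {v : ℝ | f v α = 0 ∧ v2 α < v}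

/-- `τ ↦ (v τ, z τ)` solves `v' = v f(v, α) + z²`, `z' = z f(v, α)` at every time of the
(open) set `I`. -/
def IsSolutionOn (α : ℝ) (v z : ℝ → ℝ) (I : Set ℝ) : Prop :=
  ∀ τ ∈ I, HasDerivAt v (v τ * f (v τ) α + z τ ^ 2) τ ∧ HasDerivAt z (z τ * f (v τ) α) τ

/-- `L⁻(α)`: the unstable separatrix of `P₁(α) = (v₁(α), 0)` in the upper half plane, i.e. the
points on trajectories with `z > 0` that tend to `P₁(α)` as `τ → -∞`. -/
def LMinus (α : ℝ) : Set (ℝ × ℝ) :=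
  {p | ∃ (v z : ℝ → ℝ) (T : ℝ), IsSolutionOn α v z (Set.Iio T) ∧ (∀ τ < T, 0 < z τ) ∧
    Tendsto v atBot (𝓝 (v1 α)) ∧ Tendsto z atBot (𝓝 0) ∧ ∃ τ < T, (v τ, z τ) = p}

/-- `L⁺(α)`: the stable separatrix of `P₃(α) = (v₃(α), 0)` in the upper half plane, i.e. the
points on trajectories with `z > 0` that tend to `P₃(α)` as `τ → +∞`. -/
def LPlus (α : ℝ) : Set (ℝ × ℝ) :=
  {p | ∃ (v z : ℝ → ℝ) (T : ℝ), IsSolutionOn α v z (Set.Ioi T) ∧ (∀ τ > T, 0 < z τ) ∧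
    Tendsto v atTop (𝓝 (v3 α)) ∧ Tendsto z atTop (𝓝 0) ∧ ∃ τ > T, (v τ, z τ) = p}

/-- The domain `v₁ < v < v₂`, `z > 0`, `v f(v, α) + z² > 0`. -/
def D2 (α : ℝ) : Set (ℝ × ℝ) :=
  {p | 0 < p.2 ∧ v1 α < p.1 ∧ p.1 < v2 α ∧ 0 < p.1 * f p.1 α + p.2 ^ 2}

/-- The domain `v₂ ≤ v < v₃`, `z > 0`, `v f(v, α) + z² > 0`. -/
def D3 (α : ℝ) : Set (ℝ × ℝ) :=
  {p | 0 < p.2 ∧ v2 α ≤ p.1 ∧ p.1 < v3 α ∧ 0 < p.1 * f p.1 α + p.2 ^ 2}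

/-- The graph of `v ↦ φ(v; v₀, z₀, α)`, where `q = (v₀, z₀)`: the part of the trajectory through
`q` on the maximal time interval around `0` on which `v' = v f(v, α) + z² > 0`. -/
def phiGraph (q : ℝ × ℝ) (α : ℝ) : Set (ℝ × ℝ) :=
  {p | ∃ (v z : ℝ → ℝ) (a b : ℝ), a < 0 ∧ 0 < b ∧ IsSolutionOn α v z (Set.Ioo a b) ∧
    (v 0, z 0) = q ∧ (∀ τ ∈ Set.Ioo a b, 0 < v τ * f (v τ) α + z τ ^ 2) ∧
    ∃ τ ∈ Set.Ioo a b, (v τ, z τ) = p}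

/-- The graph of `φ⁻(·; α)` on its natural domain `(v₁(α), v⁻(α))`. -/
def phiMinusGraph (α : ℝ) : Set (ℝ × ℝ) :=
  {p | ∃ q ∈ D2 α ∩ LMinus α, p ∈ phiGraph q α}

/-- The graph of `φ⁺(·; α)` on its natural domain `(v⁺(α), v₃(α))`. -/
def phiPlusGraph (α : ℝ) : Set (ℝ × ℝ) :=
  {p | ∃ q ∈ D3 α ∩ LPlus α, p ∈ phiGraph q α}

/-- `z` is the value `φ⁻(v; α)`. If the natural domain is `(v₁(α), 0)`, that is `v⁻(α) = 0`, then
`φ⁻(0; α)` means the left limit of `φ⁻(·; α)` at `0`. -/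
def IsPhiMinus (v α z : ℝ) : Prop :=
  (v, z) ∈ phiMinusGraph α ∨
    (v = 0 ∧ Prod.fst '' phiMinusGraph α = Set.Ioo (v1 α) 0 ∧
      ∃ φ : ℝ → ℝ, (∀ w ∈ Set.Ioo (v1 α) 0, (w, φ w) ∈ phiMinusGraph α) ∧
        Tendsto φ (𝓝[<] 0) (𝓝 z))

/-- `z` is the value `φ⁺(v; α)`. -/
def IsPhiPlus (v α z : ℝ) : Prop := (v, z) ∈ phiPlusGraph α

/-- The height `φ⁻(v; α)` of `L⁻(α)` over `v` (an arbitrary number where it is undefined). -/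
def phiMinus (v α : ℝ) : ℝ := Classical.epsilon fun z => IsPhiMinus v α z

/-- The height `φ⁺(v; α)` of `L⁺(α)` over `v` (an arbitrary number where it is undefined). -/
def phiPlus (v α : ℝ) : ℝ := Classical.epsilon fun z => IsPhiPlus v α z

end PolySys

end

/-! In the upper half plane put `w = v / z`. The system gives `w' = z`, so along a trajectory `z` is
a function `Z` of `s = w` solving the scalar equation `dZ/ds = f(sZ, α)`, with `v = sZ`. The
equilibrium `(v₁, 0)` is pushed to `s = -∞`, and its separatrix becomes the solution `ζ` (a
"profile") with `s ζ(s) → v₁`. The argument of the cubic is truncated to `[-B, B]`, which makes all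
solutions global and is inactive where it matters.

For very negative `s` the strip `v₁ ≤ sZ ≤ m` is forward invariant, and differences of solutions
inside it shrink as `s` grows, because the cubic increases on `(-∞, m]` and `s < 0`. Hence exactly
one solution stays in the strip back to `-∞`: existence is monotone shooting
(`Admissible.exists_isProfile`), while uniqueness and Lipschitz dependence on the parameter are one
comparison (`IsProfile.sub_le`). Gronwall extends the dependence to `s ≤ 0` (`exists_abs_sub_le`).

While `s ≤ 0` and `ζ > 0`, the function `s ζ(s)` is strictly increasing (`IsProfile.speed_pos`),
which is exactly `dv/dτ > 0`. So the height over `v < 0` is `ζ(s)` for the unique `s < 0` with `s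
ζ(s) = v`, and the height over `0` is `max (ζ 0) 0`; both are continuous in the parameter. The
reflection `(v, τ) ↦ (-v, -τ)` turns the right equilibrium into a left one with coefficients `(-α,
-1)`, which is why `cubic a b` is studied for both signs of `b`. -/

namespace PolySys

/-! ### Scalar differential inequalities -/

/-- A function satisfying a linear differential inequality `|h'| ≤ K |h|` on an interval and
vanishing at one point of it vanishes identically. -/
lemma eq_zero_of_abs_deriv_le {h h' : ℝ → ℝ} {K x y t₀ : ℝ} (ht₀ : t₀ ∈ Set.Icc x y)
    (hd : ∀ t ∈ Set.Icc x y, HasDerivAt h (h' t) t)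
    (hb : ∀ t ∈ Set.Icc x y, |h' t| ≤ K * |h t|) (h0 : h t₀ = 0) :
    ∀ t ∈ Set.Icc x y, h t = 0 := by
  intro t ht
  rcases le_total t₀ t with hle | hle
  · have hsub : Set.Icc t₀ t ⊆ Set.Icc x y := Set.Icc_subset_Icc ht₀.1 ht.2
    exact eq_zero_of_abs_deriv_le_mul_abs_self_of_eq_zero_right (K := K) (f' := h')
      (fun s hs => (hd s (hsub hs)).continuousAt.continuousWithinAt)
      (fun s hs => (hd s (hsub (Set.Ico_subset_Icc_self hs))).hasDerivWithinAt) h0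
      (fun s hs => by simpa using hb s (hsub (Set.Ico_subset_Icc_self hs))) t ⟨hle, le_rfl⟩
  · have hsub : ∀ s ∈ Set.Icc (-t₀) (-t), -s ∈ Set.Icc x y := fun s hs =>
      ⟨by linarith [ht.1, hs.2], by linarith [ht₀.2, hs.1]⟩
    have hd' : ∀ s ∈ Set.Icc (-t₀) (-t), HasDerivAt (fun s => h (-s)) (-h' (-s)) s := by
      intro s hs
      have := (hd (-s) (hsub s hs)).scomp s (hasDerivAt_neg s)
      simpa [Function.comp_def] using this
    have := eq_zero_of_abs_deriv_le_mul_abs_self_of_eq_zero_right (K := K)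
      (f := fun s => h (-s)) (f' := fun s => -h' (-s))
      (fun s hs => (hd' s hs).continuousAt.continuousWithinAt)
      (fun s hs => (hd' s (Set.Ico_subset_Icc_self hs)).hasDerivWithinAt) (by simpa using h0)
      (fun s hs => by simpa using hb (-s) (hsub s (Set.Ico_subset_Icc_self hs))) (-t)
      ⟨by linarith, le_rfl⟩
    simpa using this

/-- A function that can only cross zero upwards stays nonnegative. -/
lemma nonneg_of_deriv_pos_of_eq_zero {h h' : ℝ → ℝ} {x y : ℝ} (hxy : x ≤ y)
    (hd : ∀ t ∈ Set.Icc x y, HasDerivAt h (h' t) t) (hx : 0 ≤ h x)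
    (hc : ∀ t ∈ Set.Icc x y, h t = 0 → 0 < h' t) : 0 ≤ h y := by
  have := image_le_of_deriv_right_lt_deriv_boundary' (f := fun _ => (0 : ℝ)) (f' := fun _ => 0)
    (a := x) (b := y) continuousOn_const (fun t _ => (hasDerivAt_const t (0 : ℝ)).hasDerivWithinAt)
    (B := h) (B' := h') hx (fun t ht => (hd t ht).continuousAt.continuousWithinAt)
    (fun t ht => (hd t (Set.Ico_subset_Icc_self ht)).hasDerivWithinAt)
    (fun t ht h0 => hc t (Set.Ico_subset_Icc_self ht) h0.symm)
  exact this ⟨hxy, le_rfl⟩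

/-- A function that can only cross zero upwards stays positive. -/
lemma pos_of_deriv_pos_of_eq_zero {h h' : ℝ → ℝ} {x y : ℝ} (hxy : x < y)
    (hd : ∀ t ∈ Set.Icc x y, HasDerivAt h (h' t) t) (hx : 0 ≤ h x)
    (hc : ∀ t ∈ Set.Icc x y, h t = 0 → 0 < h' t) : 0 < h y := by
  have hnn : ∀ t ∈ Set.Icc x y, 0 ≤ h t := fun t ht =>
    nonneg_of_deriv_pos_of_eq_zero ht.1 (fun s hs => hd s ⟨hs.1, hs.2.trans ht.2⟩) hx
      (fun s hs => hc s ⟨hs.1, hs.2.trans ht.2⟩)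
  refine lt_of_le_of_ne (hnn y ⟨hxy.le, le_rfl⟩) fun h0 => ?_
  have hpos := hc y ⟨hxy.le, le_rfl⟩ h0.symm
  -- If `h y = 0`, the left difference quotients at `y` are nonpositive, yet they tend to `h' y >
  -- 0`.
  have hs := (hasDerivAt_iff_tendsto_slope_left_right.1 (hd y ⟨hxy.le, le_rfl⟩)).1
  have hev : ∀ᶠ t in 𝓝[<] y, 0 < slope h y t := hs.eventually (lt_mem_nhds hpos)
  have hev2 : ∀ᶠ t in 𝓝[<] y, t ∈ Set.Ioo x y := Ioo_mem_nhdsLT hxy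
  obtain ⟨t, ht1, ht2⟩ := (hev.and hev2).exists
  rw [slope_def_field, ← h0] at ht1
  have h1 := hnn t ⟨ht2.1.le, ht2.2.le⟩
  have h2 : (h t - 0) / (t - y) ≤ 0 := div_nonpos_of_nonneg_of_nonpos (by linarith)
    (by linarith [ht2.2])
  linarith

/-! ### The truncated slope field -/

/-- The cubic `u³ - a u² - b`. -/
def cubic (a b u : ℝ) : ℝ := u ^ 3 - a * u ^ 2 - b

/-- The derivative of `cubic a b`. -/
def cubicDeriv (a u : ℝ) : ℝ := u * (3 * u - 2 * a)

/-- The truncation of `u` to `[-B, B]`. -/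
def clamp (B u : ℝ) : ℝ := max (-B) (min u B)

/-- The slope field `dZ/ds = cubic a b (s Z)` with the argument of the cubic truncated. -/
def field (a b B s Z : ℝ) : ℝ := cubic a b (clamp B (s * Z))

lemma hasDerivAt_cubic (a b u : ℝ) : HasDerivAt (cubic a b) (cubicDeriv a u) u := by
  have := (((hasDerivAt_id u).pow 3).sub (((hasDerivAt_id u).pow 2).const_mul a)).sub_const b
  refine (this.congr_deriv ?_)
  simp [cubicDeriv]; ring

lemma continuous_cubic (a b : ℝ) : Continuous (cubic a b) := by
  unfold cubic; fun_prop

lemma clamp_of_mem {B u : ℝ} (h1 : -B ≤ u) (h2 : u ≤ B) : clamp B u = u := by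
  simp [clamp, h1, h2]

lemma abs_clamp_le {B : ℝ} (hB : 0 ≤ B) (u : ℝ) : |clamp B u| ≤ B :=
  abs_le.2 ⟨le_max_left _ _, max_le (by linarith) (min_le_right _ _)⟩

lemma abs_clamp_sub_le (B x y : ℝ) : |clamp B x - clamp B y| ≤ |x - y| := by
  unfold clamp
  exact (abs_max_sub_max_le_max _ _ _ _).trans (max_le (by simp)
    ((abs_min_sub_min_le_max _ _ _ _).trans (max_le le_rfl (by simp))))

lemma continuous_clamp (B : ℝ) : Continuous (clamp B) := by
  unfold clamp; fun_prop

lemma abs_cubic_le {a b B u : ℝ} (hu : |u| ≤ B) :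
    |cubic a b u| ≤ B ^ 3 + |a| * B ^ 2 + |b| := by
  unfold cubic
  calc |u ^ 3 - a * u ^ 2 - b| ≤ |u ^ 3| + |a * u ^ 2| + |b| :=
        (abs_sub _ _).trans (add_le_add_left (abs_sub _ _) _)
    _ ≤ _ := by
        rw [abs_mul, abs_pow, abs_pow]; gcongr

/-- The Lipschitz constant of `cubic a b` on `[-B, B]`. -/
def lipConst (a B : ℝ) : ℝ := 3 * B ^ 2 + 2 * |a| * B

lemma lipConst_nonneg {a B : ℝ} (hB : 0 ≤ B) : 0 ≤ lipConst a B := by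
  unfold lipConst; positivity

lemma abs_cubic_sub_le {a b B x y : ℝ} (hx : |x| ≤ B) (hy : |y| ≤ B) :
    |cubic a b x - cubic a b y| ≤ lipConst a B * |x - y| := by
  have hB : 0 ≤ B := (abs_nonneg x).trans hx
  have e : cubic a b x - cubic a b y = (x ^ 2 + x * y + y ^ 2 - a * (x + y)) * (x - y) := by
    unfold cubic; ring
  rw [e, abs_mul]
  refine mul_le_mul_of_nonneg_right ?_ (abs_nonneg _)
  have h1 : |x ^ 2 + x * y + y ^ 2| ≤ 3 * B ^ 2 := by
    calc |x ^ 2 + x * y + y ^ 2| ≤ |x ^ 2| + |x * y| + |y ^ 2| := abs_add_three _ _ _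
      _ = |x| ^ 2 + |x| * |y| + |y| ^ 2 := by simp [abs_mul]
      _ ≤ B ^ 2 + B * B + B ^ 2 := by gcongr
      _ = _ := by ring
  have h2 : |a * (x + y)| ≤ 2 * |a| * B := by
    rw [abs_mul]
    have : |x + y| ≤ 2 * B := (abs_add_le _ _).trans (by linarith)
    nlinarith [abs_nonneg a]
  exact (abs_sub _ _).trans (add_le_add h1 h2)

lemma abs_field_le {a b B : ℝ} (hB : 0 ≤ B) (s Z : ℝ) :
    |field a b B s Z| ≤ B ^ 3 + |a| * B ^ 2 + |b| := abs_cubic_le (abs_clamp_le hB _)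

lemma abs_field_sub_le {a b B : ℝ} (hB : 0 ≤ B) (s X Y : ℝ) :
    |field a b B s X - field a b B s Y| ≤ lipConst a B * |s| * |X - Y| := by
  refine (abs_cubic_sub_le (abs_clamp_le hB _) (abs_clamp_le hB _)).trans ?_
  rw [mul_assoc, ← abs_mul, mul_sub]
  exact mul_le_mul_of_nonneg_left (abs_clamp_sub_le _ _ _) (lipConst_nonneg hB)

lemma abs_field_sub_field_le {a a' b B : ℝ} (hB : 0 ≤ B) (s Z : ℝ) :
    |field a b B s Z - field a' b B s Z| ≤ |a - a'| * B ^ 2 := by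
  have h := abs_clamp_le hB (s * Z)
  have e : field a b B s Z - field a' b B s Z = -((a - a') * clamp B (s * Z) ^ 2) := by
    unfold field cubic; ring
  rw [e, abs_neg, abs_mul, abs_pow]
  gcongr

lemma field_of_mem {a b B s Z : ℝ} (h1 : -B ≤ s * Z) (h2 : s * Z ≤ B) :
    field a b B s Z = cubic a b (s * Z) := by
  rw [field, clamp_of_mem h1 h2]

lemma continuous_field (a b B Z : ℝ) : Continuous fun s => field a b B s Z := by
  unfold field
  exact (continuous_cubic a b).comp ((continuous_clamp B).comp (by fun_prop))

/-- Two solutions of the truncated equation that meet are equal. -/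
lemma field_solution_unique {a b B x y s₀ : ℝ} (hB : 0 ≤ B) {X Y : ℝ → ℝ}
    (hX : ∀ s ∈ Set.Icc x y, HasDerivAt X (field a b B s (X s)) s)
    (hY : ∀ s ∈ Set.Icc x y, HasDerivAt Y (field a b B s (Y s)) s)
    (hs₀ : s₀ ∈ Set.Icc x y) (h0 : X s₀ = Y s₀) : ∀ s ∈ Set.Icc x y, X s = Y s := by
  have := eq_zero_of_abs_deriv_le (h := fun s => X s - Y s) (K := lipConst a B * max |x| |y|) hs₀
    (fun s hs => (hX s hs).sub (hY s hs)) (fun s hs => by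
      refine (abs_field_sub_le hB _ _ _).trans ?_
      have h1 : |s| ≤ max |x| |y| := abs_le_max_abs_abs hs.1 hs.2
      have := lipConst_nonneg (a := a) hB
      gcongr) (by simp [h0])
  intro s hs
  exact sub_eq_zero.1 (this s hs)

/-- The truncated equation has a solution on every bounded interval. -/
lemma exists_field_solution_Ioo {a b B : ℝ} (hB : 0 ≤ B) (s₀ z₀ : ℝ) {N : ℝ} (hN : |s₀| ≤ N) :
    ∃ X : ℝ → ℝ, X s₀ = z₀ ∧ ∀ s ∈ Set.Ioo (-N) N, HasDerivAt X (field a b B s (X s)) s := by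
  have hN0 : 0 ≤ N := (abs_nonneg _).trans hN
  set L : NNReal := Real.toNNReal (B ^ 3 + |a| * B ^ 2 + |b|)
  set K : NNReal := Real.toNNReal (lipConst a B * N)
  -- The field is bounded by `L`, so in time at most `2N` no solution leaves the ball of radius `A`:
  -- the interval need not be shortened.
  set A : NNReal := L * Real.toNNReal (2 * N)
  have hpl : IsPicardLindelof (field a b B) (tmin := -N) (tmax := N) ⟨s₀, abs_le.1 hN⟩ z₀ A 0 L K :=
    { lipschitzOnWith := by
        intro t ht
        refine LipschitzOnWith.of_dist_le_mul fun X _ Y _ => ?_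
        rw [Real.dist_eq, Real.dist_eq, Real.coe_toNNReal _ (mul_nonneg (lipConst_nonneg hB) hN0)]
        refine (abs_field_sub_le hB _ _ _).trans ?_
        have := lipConst_nonneg (a := a) hB
        have := abs_le.2 ht
        gcongr
      continuousOn := fun Z _ => (continuous_field a b B Z).continuousOn
      norm_le := fun t _ X _ => (abs_field_le hB t X).trans (Real.le_coe_toNNReal _)
      mul_max_le := by
        have h1 : max (N - s₀) (s₀ - -N) ≤ 2 * N := by
          have := abs_le.1 hN
          exact max_le (by linarith) (by linarith)
        simp only [NNReal.coe_zero, sub_zero, A, NNReal.coe_mul]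
        exact mul_le_mul_of_nonneg_left (h1.trans (Real.le_coe_toNNReal _)) L.2 }
  obtain ⟨X, h0, hX⟩ := hpl.exists_eq_forall_mem_Icc_hasDerivWithinAt₀
  exact ⟨X, h0, fun s hs => (hX s (Set.Ioo_subset_Icc_self hs)).hasDerivAt (Icc_mem_nhds hs.1 hs.2)⟩

/-- The truncated equation has global solutions. -/
lemma exists_field_solution {a b B : ℝ} (hB : 0 ≤ B) (s₀ z₀ : ℝ) :
    ∃ X : ℝ → ℝ, X s₀ = z₀ ∧ ∀ s, HasDerivAt X (field a b B s (X s)) s := by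
  choose X h0 hX using fun n : ℕ =>
    exists_field_solution_Ioo (a := a) (b := b) hB s₀ z₀ (N := |s₀| + 1 + n)
      (by have := n.cast_nonneg (α := ℝ); linarith)
  have hagree : ∀ (m n : ℕ) (s : ℝ), |s| < |s₀| + 1 + m → |s| < |s₀| + 1 + n → X m s = X n s := by
    intro m n s hm hn
    have key : ∀ t ∈ Set.Icc (min s s₀) (max s s₀), |t| ≤ max |s| |s₀| := fun t ht => by
      refine (abs_le_max_abs_abs ht.1 ht.2).trans (max_le ?_ ?_)
      · rcases min_choice s s₀ with h | h <;> rw [h] <;> simp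
      · rcases max_choice s s₀ with h | h <;> rw [h] <;> simp
    have hm0 := m.cast_nonneg (α := ℝ)
    have hn0 := n.cast_nonneg (α := ℝ)
    refine field_solution_unique hB (x := min s s₀) (y := max s s₀) (s₀ := s₀)
      (fun t ht => hX m t (abs_lt.1 ((key t ht).trans_lt (max_lt hm (by linarith)))))
      (fun t ht => hX n t (abs_lt.1 ((key t ht).trans_lt (max_lt hn (by linarith)))))
      ⟨min_le_right _ _, le_max_right _ _⟩ ((h0 m).trans (h0 n).symm) s
      ⟨min_le_left _ _, le_max_left _ _⟩
  have hceil : ∀ s : ℝ, |s| < |s₀| + 1 + (⌈|s|⌉₊ : ℝ) := fun s => by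
    linarith [Nat.le_ceil |s|, abs_nonneg s₀]
  -- Glue the solutions on growing intervals; by uniqueness the index is irrelevant locally.
  refine ⟨fun s => X ⌈|s|⌉₊ s, h0 _, fun s => ?_⟩
  have hd := hX ⌈|s|⌉₊ s (abs_lt.1 (hceil s))
  refine hd.congr_of_eventuallyEq ?_
  have : ∀ᶠ t in 𝓝 s, |t| < |s₀| + 1 + (⌈|s|⌉₊ : ℝ) :=
    continuous_abs.continuousAt.eventually (gt_mem_nhds (hceil s))
  filter_upwards [this] with t ht
  exact hagree _ _ t (hceil t) ht

/-- Solutions of the truncated equation do not cross. -/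
lemma field_solution_le {a b B : ℝ} (hB : 0 ≤ B) {X Y : ℝ → ℝ}
    (hX : ∀ s, HasDerivAt X (field a b B s (X s)) s)
    (hY : ∀ s, HasDerivAt Y (field a b B s (Y s)) s) {s₀ : ℝ} (h0 : X s₀ ≤ Y s₀) (s : ℝ) :
    X s ≤ Y s := by
  by_contra! hlt
  have hc : Continuous fun s => Y s - X s := continuous_iff_continuousAt.2 fun t =>
    (hY t).continuousAt.sub (hX t).continuousAt
  obtain ⟨t, -, ht⟩ := intermediate_value_uIcc (a := s) (b := s₀) hc.continuousOn
    (show (0 : ℝ) ∈ Set.uIcc (Y s - X s) (Y s₀ - X s₀) from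
      Set.mem_uIcc.2 (Or.inl ⟨by linarith, by linarith⟩))
  have := field_solution_unique hB (x := min s t) (y := max s t) (s₀ := t) (fun s _ => hX s)
    (fun s _ => hY s) ⟨min_le_right _ _, le_max_right _ _⟩ (by linarith) s
    ⟨min_le_left _ _, le_max_left _ _⟩
  linarith

/-! ### The special solution of the slope equation -/

/-- Conditions under which the slope equation has a unique solution `ζ` with `s ζ(s) → r` as
`s → -∞`: `r` is a zero of the cubic, which is strictly increasing up to `m < 0`. The number `M`
is so large that `s ζ(s) ≤ m` is a trapping condition for `s ≤ -M`. -/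
structure Admissible (a b B r m M : ℝ) : Prop where
  root : cubic a b r = 0
  lt : r < m
  neg : m < 0
  slope : 3 * m < 2 * a
  lb : -B < r
  pos : 0 < M
  large : -m < M ^ 2 * cubic a b m

/-- `ζ` solves the truncated slope equation, and `s ζ(s)` lies in `[r, m]` for `s ≤ -M`. -/
structure IsProfile (a b B r m M : ℝ) (ζ : ℝ → ℝ) : Prop where
  deriv : ∀ s, HasDerivAt ζ (field a b B s (ζ s)) s
  mem : ∀ s ≤ -M, r ≤ s * ζ s ∧ s * ζ s ≤ m

/-- Lower bound for the slope of the cubic on `(-∞, m]`. -/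
lemma le_cubic_sub {a b m x y : ℝ} (hm : m < 0) (hs : 3 * m < 2 * a) (hxy : x ≤ y) (hy : y ≤ m) :
    cubicDeriv a m * (y - x) ≤ cubic a b y - cubic a b x := by
  have e : cubic a b y - cubic a b x = (x ^ 2 + x * y + y ^ 2 - a * (x + y)) * (y - x) := by
    unfold cubic; ring
  rw [e]
  refine mul_le_mul_of_nonneg_right ?_ (by linarith)
  -- In these variables the quotient minus `cubicDeriv a m` is `(p + q)(a - 3m) + p² + pq + q²`, and
  -- `a > 3m/2 > 3m`.
  obtain ⟨p, rfl⟩ : ∃ p, x = m - p := ⟨m - x, by ring⟩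
  obtain ⟨q, rfl⟩ : ∃ q, y = m - q := ⟨m - y, by ring⟩
  have hp : 0 ≤ p := by linarith
  have hq : 0 ≤ q := by linarith
  have h1 : 0 ≤ (p + q) * (a - 3 * m) := mul_nonneg (by linarith) (by linarith)
  have h2 : 0 ≤ p * q := mul_nonneg hp hq
  unfold cubicDeriv
  nlinarith [sq_nonneg p, sq_nonneg q]

lemma cubicDeriv_pos {a m : ℝ} (hm : m < 0) (hs : 3 * m < 2 * a) : 0 < cubicDeriv a m :=
  mul_pos_of_neg_of_neg hm (by linarith)

lemma cubic_le_cubic {a b m x y : ℝ} (hm : m < 0) (hs : 3 * m < 2 * a) (hxy : x ≤ y)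
    (hy : y ≤ m) : cubic a b x ≤ cubic a b y := by
  have h1 := le_cubic_sub (b := b) hm hs hxy hy
  have h2 := mul_nonneg (cubicDeriv_pos hm hs).le (sub_nonneg.2 hxy)
  linarith

lemma cubic_lt_cubic {a b m x y : ℝ} (hm : m < 0) (hs : 3 * m < 2 * a) (hxy : x < y)
    (hy : y ≤ m) : cubic a b x < cubic a b y := by
  have h1 := le_cubic_sub (b := b) hm hs hxy.le hy
  have h2 := mul_pos (cubicDeriv_pos hm hs) (sub_pos.2 hxy)
  linarith

/-! ### The trapping strip and existence of a profile -/

namespace Admissible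

variable {a b B r m M : ℝ}

lemma r_neg (h : Admissible a b B r m M) : r < 0 := h.lt.trans h.neg

lemma B_pos (h : Admissible a b B r m M) : 0 < B := by linarith [h.lb, h.r_neg]

/-- The region `r ≤ s X` is forward invariant for `s < 0`. -/
lemma root_le (h : Admissible a b B r m M) {X : ℝ → ℝ}
    (hX : ∀ s, HasDerivAt X (field a b B s (X s)) s) {s₁ s₂ : ℝ} (h12 : s₁ ≤ s₂) (h2 : s₂ < 0)
    (h0 : r ≤ s₁ * X s₁) : r ≤ s₂ * X s₂ := by
  have := nonneg_of_deriv_pos_of_eq_zero (h := fun s => s * X s - r) h12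
    (fun s _ => ((hasDerivAt_id s).mul (hX s)).sub_const r) (by linarith) (fun s hs h0 => by
      have hsX : s * X s = r := by linarith
      have hf : field a b B s (X s) = 0 := by
        rw [field_of_mem (by linarith [h.lb]) (by linarith [h.r_neg, h.B_pos]), hsX, h.root]
      have : 0 < X s := by
        by_contra! hneg
        have := mul_nonneg_of_nonpos_of_nonpos (hs.2.trans h2.le) hneg
        linarith [h.r_neg]
      simpa [hf] using this)
  linarith

/-- The region `s X ≤ m` is forward invariant for `s ≤ -M`. -/
lemma le_m (h : Admissible a b B r m M) {X : ℝ → ℝ}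
    (hX : ∀ s, HasDerivAt X (field a b B s (X s)) s) {s₁ s₂ : ℝ} (h12 : s₁ ≤ s₂) (h2 : s₂ ≤ -M)
    (h0 : s₁ * X s₁ ≤ m) : s₂ * X s₂ ≤ m := by
  have := nonneg_of_deriv_pos_of_eq_zero (h := fun s => m - s * X s) h12
    (fun s _ => ((hasDerivAt_id s).mul (hX s)).const_sub m) (by linarith) (fun s hs h0 => by
      have hsX : s * X s = m := by linarith
      have hsneg : s < 0 := by linarith [hs.2, h.pos]
      rw [field_of_mem (by linarith [h.lb, h.lt]) (by linarith [h.neg, h.B_pos]), hsX]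
      have hg : 0 < cubic a b m := by
        by_contra! hg
        have := mul_nonpos_of_nonneg_of_nonpos (sq_nonneg M) hg
        linarith [h.large, h.neg]
      have hsq : M ^ 2 ≤ s ^ 2 := by nlinarith [hs.2, h.pos]
      have h3 : -m < s ^ 2 * cubic a b m :=
        h.large.trans_le (mul_le_mul_of_nonneg_right hsq hg.le)
      -- On the boundary `s X = m` this product equals `m + s² g(m)`, positive by `large`; as `s <
      -- 0`, the derivative of `s X` is negative.
      have h4 : s * (X s + s * cubic a b m) > 0 := by nlinarith
      have h5 : X s + s * cubic a b m < 0 := by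
        by_contra! hc
        have := mul_nonpos_of_nonpos_of_nonneg hsneg.le hc
        linarith
      simp only [id]
      linarith)
  linarith

/-- Shooting from `σ n → -∞`: start `X n` on the boundary `sX = r` and `Y n` on `sY = m`. Forward
invariance and non-crossing make the values at `-M` nested intervals `[Y n, X n]`, and a solution
through a common point lies in the strip at every `σ n`, hence at every `s ≤ -M`. -/
lemma exists_isProfile (h : Admissible a b B r m M) : ∃ ζ, IsProfile a b B r m M ζ := by
  have hB := h.B_pos.le
  set σ : ℕ → ℝ := fun n => -M - n with hσ
  have hσneg : ∀ n, σ n < 0 := fun n => by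
    have := n.cast_nonneg (α := ℝ); simp only [hσ]; linarith [h.pos]
  have hσle : ∀ n, σ n ≤ -M := fun n => by
    have := n.cast_nonneg (α := ℝ); simp only [hσ]; linarith
  have hσsucc : ∀ n, σ (n + 1) ≤ σ n := fun n => by simp only [hσ]; push_cast; linarith
  choose X hX0 hX using fun n => exists_field_solution (a := a) (b := b) hB (σ n) (r / σ n)
  choose Y hY0 hY using fun n => exists_field_solution (a := a) (b := b) hB (σ n) (m / σ n)
  have hXσ : ∀ n, σ n * X n (σ n) = r := fun n => by
    rw [hX0, mul_div_cancel₀ _ (hσneg n).ne]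
  have hYσ : ∀ n, σ n * Y n (σ n) = m := fun n => by
    rw [hY0, mul_div_cancel₀ _ (hσneg n).ne]
  have hle : ∀ {s u v : ℝ}, s < 0 → s * u ≤ s * v → v ≤ u := fun hs huv =>
    (mul_le_mul_left_of_neg hs).1 huv
  have hXanti : Antitone fun n => X n (-M) := antitone_nat_of_succ_le fun n =>
    field_solution_le hB (hX _) (hX _) (hle (hσneg n) (by
      rw [hXσ]; exact h.root_le (hX _) (hσsucc n) (hσneg n) (hXσ _).ge)) _
  have hYmono : Monotone fun n => Y n (-M) := monotone_nat_of_le_succ fun n =>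
    field_solution_le hB (hY _) (hY _) (hle (hσneg n) (by
      rw [hYσ]; exact h.le_m (hY _) (hσsucc n) (hσle n) (hYσ _).le)) _
  have hYX : (fun n => Y n (-M)) ≤ fun n => X n (-M) := fun n =>
    field_solution_le hB (hY _) (hX _) (hle (hσneg n) (by rw [hXσ, hYσ]; exact h.lt.le)) _
  have hz := hYmono.ciSup_mem_iInter_Icc_of_antitone hXanti hYX
  set z := ⨆ n, Y n (-M)
  obtain ⟨ζ, h0, hζ⟩ := exists_field_solution (a := a) (b := b) hB (-M) z
  refine ⟨ζ, hζ, fun s hs => ?_⟩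
  obtain ⟨n, hn⟩ := exists_nat_ge (-M - s)
  have hns : σ n ≤ s := by simp only [hσ]; linarith
  have hzn := Set.mem_iInter.1 hz n
  have h1 := field_solution_le hB (hY n) hζ (h0 ▸ hzn.1) (σ n)
  have h2 := field_solution_le hB hζ (hX n) (h0 ▸ hzn.2) (σ n)
  refine ⟨h.root_le hζ hns (by linarith [h.pos]) ?_, h.le_m hζ hns hs ?_⟩
  · exact (hXσ n).ge.trans (mul_le_mul_of_nonpos_left h2 (hσneg n).le)
  · exact (mul_le_mul_of_nonpos_left h1 (hσneg n).le).trans (hYσ n).le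

end Admissible

/-- Functions `h` with `h → 0` at `-∞` that are nonincreasing where positive are `≤ 0`; the
tolerance `η` replaces zero. -/
lemma le_of_deriv_nonpos_of_tendsto {h h' : ℝ → ℝ} {T η : ℝ} (hη : 0 ≤ η)
    (hd : ∀ t ≤ T, HasDerivAt h (h' t) t) (hneg : ∀ t ≤ T, η < h t → h' t ≤ 0)
    (h0 : Tendsto h atBot (𝓝 0)) : ∀ t ≤ T, h t ≤ η := by
  intro t₁ ht₁
  by_contra! hlt
  have hge : ∀ t ≤ t₁, h t₁ ≤ h t := by
    intro t ht
    by_contra! hlt'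
    obtain ⟨c, hc1, hc2⟩ := exists_between (max_lt hlt hlt')
    have hηc := (le_max_left _ _).trans_lt hc1
    have hpos : 0 < t₁ - t + 1 := by linarith
    -- The line `c + ε (s - t)` starts above `h t` and ends at `h t₁ - ε`. Wherever `h` meets it, `h
    -- > η`, so `h' ≤ 0 < ε` and `h` cannot get above it.
    set ε := (h t₁ - c) / (t₁ - t + 1)
    have hε : 0 < ε := div_pos (by linarith) hpos
    have hεe : ε * (t₁ - t + 1) = h t₁ - c := div_mul_cancel₀ _ hpos.ne'
    have := nonneg_of_deriv_pos_of_eq_zero (h := fun s => c + ε * (s - t) - h s) ht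
      (fun s hs => ((((hasDerivAt_id s).sub_const t).const_mul ε).const_add c).sub
        (hd s (hs.2.trans ht₁))) (by linarith [le_max_right η (h t)]) (fun s hs h0 => by
          have : 0 ≤ ε * (s - t) := mul_nonneg hε.le (by linarith [hs.1])
          have := hneg s (hs.2.trans ht₁) (by linarith)
          linarith)
    linarith
  have : h t₁ ≤ 0 := ge_of_tendsto h0 ((eventually_le_atBot t₁).mono fun t ht => hge t ht)
  linarith

/-! ### Comparison, asymptotics and monotonicity of profiles -/

namespace IsProfile

variable {a b B r m M : ℝ} {ζ : ℝ → ℝ}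

lemma continuous (h : IsProfile a b B r m M ζ) : Continuous ζ :=
  continuous_iff_continuousAt.2 fun s => (h.deriv s).continuousAt

lemma mono (h : IsProfile a b B r m M ζ) {M' m' : ℝ} (hM : M ≤ M') (hm : m ≤ m') :
    IsProfile a b B r m' M' ζ :=
  ⟨h.deriv, fun s hs => ⟨(h.mem s (by linarith)).1, (h.mem s (by linarith)).2.trans hm⟩⟩

/-- `ζ` tends to zero at `-∞`. -/
lemma tendsto_zero (h : IsProfile a b B r m M ζ) : Tendsto ζ atBot (𝓝 0) := by
  have hb : ∀ᶠ s in atBot, ‖s * ζ s‖ ≤ max |r| |m| := (eventually_le_atBot (-M)).mono fun s hs => by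
    rw [Real.norm_eq_abs]
    exact abs_le_max_abs_abs (h.mem s hs).1 (h.mem s hs).2
  have := (tendsto_inv_atBot_zero (𝕜 := ℝ)).zero_mul_isBoundedUnder_le
    (g := fun s => s * ζ s) ⟨_, eventually_map.2 hb⟩
  refine this.congr' ((eventually_lt_atBot 0).mono fun s hs => ?_)
  rw [← mul_assoc, inv_mul_cancel₀ hs.ne, one_mul]

/-- Comparison of two profiles with different parameters: near `-∞` their distance is controlled
by the distance of the parameters. -/
lemma sub_le (h : IsProfile a b B r m M ζ) {a' r' m' : ℝ} {ζ' : ℝ → ℝ}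
    (h' : IsProfile a' b B r' m' M ζ') (ha : 3 * m < 2 * a) (hm : m < 0) (hm' : m' ≤ m)
    (hM : 0 < M) (hr : -B ≤ r) (hr' : -B ≤ r') {c : ℝ} (hc : 0 < c) (hca : c ≤ cubicDeriv a m) :
    ∀ s ≤ -M, ζ s - ζ' s ≤ |a - a'| * B ^ 2 / (c * M) ∧
      ζ' s - ζ s ≤ |a - a'| * B ^ 2 / (c * M) := by
  have hη : 0 ≤ |a - a'| * B ^ 2 / (c * M) := by positivity
  have hηe : |a - a'| * B ^ 2 / (c * M) * (c * M) = |a - a'| * B ^ 2 :=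
    div_mul_cancel₀ _ (by positivity)
  have hfield : ∀ s ≤ -M, field a b B s (ζ s) = cubic a b (s * ζ s) ∧
      field a b B s (ζ' s) = cubic a b (s * ζ' s) ∧
      |field a b B s (ζ' s) - field a' b B s (ζ' s)| ≤ |a - a'| * B ^ 2 := fun s hs => by
    have h1 := h.mem s hs
    have h2 := h'.mem s hs
    have hB : 0 ≤ B := by linarith
    exact ⟨field_of_mem (by linarith) (by linarith), field_of_mem (by linarith) (by linarith),
      abs_field_sub_field_le hB _ _⟩
  -- The tolerance `|a - a'| B² / (c M)` is where the contraction, of rate at least `c M`, balances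
  -- the error `|a - a'| B²` made by changing the parameter.
  have hslope : ∀ s ≤ -M, ∀ x y : ℝ, s * x ≤ m → s * y ≤ m →
      |a - a'| * B ^ 2 / (c * M) < x - y →
      cubic a b (s * x) - cubic a b (s * y) ≤ -(|a - a'| * B ^ 2) := fun s hs x y hx hy hxy => by
    have hyx : s * x ≤ s * y := mul_le_mul_of_nonpos_left (by linarith) (by linarith)
    have h1 := le_cubic_sub (b := b) hm ha hyx hy
    have h2 : c * (s * y - s * x) ≤ cubicDeriv a m * (s * y - s * x) :=
      mul_le_mul_of_nonneg_right hca (by linarith)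
    have h3 : M * (x - y) ≤ s * y - s * x := by nlinarith
    have h4 : c * M * (|a - a'| * B ^ 2 / (c * M)) ≤ c * (s * y - s * x) := by
      rw [mul_assoc]
      refine mul_le_mul_of_nonneg_left ?_ hc.le
      exact (mul_le_mul_of_nonneg_left hxy.le hM.le).trans h3
    linarith
  intro s hs
  refine ⟨le_of_deriv_nonpos_of_tendsto hη (fun t _ => (h.deriv t).sub (h'.deriv t))
    (fun t ht hlt => ?_) (by simpa [Pi.sub_def] using h.tendsto_zero.sub h'.tendsto_zero) s hs,
    le_of_deriv_nonpos_of_tendsto hη (fun t _ => (h'.deriv t).sub (h.deriv t))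
    (fun t ht hlt => ?_) (by simpa [Pi.sub_def] using h'.tendsto_zero.sub h.tendsto_zero) s hs⟩
  · obtain ⟨h1, h2, h3⟩ := hfield t ht
    have h4 := hslope t ht _ _ (h.mem t ht).2 ((h'.mem t ht).2.trans hm') hlt
    have := (abs_le.1 h3).2
    linarith
  · obtain ⟨h1, h2, h3⟩ := hfield t ht
    have h4 := hslope t ht _ _ ((h'.mem t ht).2.trans hm') (h.mem t ht).2 hlt
    have := (abs_le.1 h3).1
    linarith

lemma root_le (h : IsProfile a b B r m M ζ) (ha : Admissible a b B r m M) {s : ℝ} (hs : s ≤ 0) :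
    r ≤ s * ζ s := by
  rcases hs.eq_or_lt with rfl | hs
  · simpa using ha.r_neg.le
  · rcases le_total s (-M) with h1 | h1
    · exact (h.mem s h1).1
    · exact ha.root_le h.deriv h1 hs (h.mem _ le_rfl).1

/-- `s ζ(s)` tends to the root at `-∞`. -/
lemma tendsto_mul (h : IsProfile a b B r m M ζ) (ha : Admissible a b B r m M) :
    Tendsto (fun s => s * ζ s) atBot (𝓝 r) := by
  rw [tendsto_order]
  refine ⟨fun x hx => (eventually_le_atBot (-M)).mono fun s hs => hx.trans_le (h.mem s hs).1,
    fun x hx => ?_⟩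
  obtain ⟨m', hrm', hm'⟩ := exists_between (lt_min hx ha.lt)
  have hm'm : m' < m := hm'.trans_le (min_le_right _ _)
  have hm'neg : m' < 0 := hm'm.trans ha.neg
  have hs' : 3 * m' < 2 * a := by linarith [ha.slope]
  have hg : 0 < cubic a b m' := by
    rw [← ha.root]; exact cubic_lt_cubic hm'neg hs' hrm' le_rfl
  obtain ⟨M', hM', hMM'⟩ : ∃ M', M ≤ M' ∧ -m' < M' ^ 2 * cubic a b m' := by
    have : Tendsto (fun M' : ℝ => M' ^ 2 * cubic a b m') atTop atTop :=
      (tendsto_pow_atTop two_ne_zero).atTop_mul_const hg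
    obtain ⟨M', h1, h2⟩ := ((eventually_ge_atTop M).and (this.eventually_gt_atTop (-m'))).exists
    exact ⟨M', h1, h2⟩
  have ha' : Admissible a b B r m' M' :=
    ⟨ha.root, hrm', hm'neg, hs', ha.lb, ha.pos.trans_le hM', hMM'⟩
  obtain ⟨ζ', hζ'⟩ := ha'.exists_isProfile
  filter_upwards [eventually_le_atBot (-M')] with s hs
  -- With equal parameters the comparison bound is zero, so `ζ` coincides with the profile of the
  -- narrower strip `s ζ' ≤ m' < x`.
  have key := (h.mono hM' le_rfl).sub_le (hζ'.mono le_rfl hm'm.le) ha.slope ha.neg le_rfl ha'.pos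
    ha.lb.le ha.lb.le (cubicDeriv_pos ha.neg ha.slope) le_rfl s hs
  simp only [sub_self, abs_zero, zero_mul, zero_div] at key
  have : ζ s = ζ' s := by linarith
  rw [this]
  exact (hζ'.mem s hs).2.trans_lt (hm'.trans_le (min_le_left _ _))

lemma pos_of_le (h : IsProfile a b B r m M ζ) (ha : Admissible a b B r m M) {s : ℝ}
    (hs : s ≤ -M) : 0 < ζ s := by
  by_contra! hneg
  have := mul_nonneg_of_nonpos_of_nonpos (show s ≤ 0 by linarith [ha.pos]) hneg
  linarith [(h.mem s hs).2, ha.neg]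

lemma field_eq_of_eq_zero (ha : Admissible a b B r m M) {s : ℝ} (hz : ζ s = 0) :
    field a b B s (ζ s) = -b := by
  rw [field_of_mem (by simp [hz, ha.B_pos.le]) (by simp [hz, ha.B_pos.le]), hz]
  simp [cubic]

/-- Positivity of a profile propagates to the left. -/
lemma pos_of_pos (h : IsProfile a b B r m M ζ) (ha : Admissible a b B r m M) (hb : b ≠ 0)
    {s t : ℝ} (hts : t ≤ s) (hpos : 0 < ζ s) : 0 < ζ t := by
  rcases hts.eq_or_lt with rfl | hts
  · exact hpos
  -- At a zero the slope of `ζ` is `-b`. For `b < 0` zeros are crossed only upwards, starting from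
  -- `ζ(-M) > 0`; for `b > 0` a nonpositive value would persist to the right.
  rcases hb.lt_or_gt with hb | hb
  · rcases le_or_gt t (-M) with h1 | h1
    · exact h.pos_of_le ha h1
    · refine pos_of_deriv_pos_of_eq_zero h1 (fun s _ => h.deriv s)
        (h.pos_of_le ha le_rfl).le (fun s _ h0 => ?_)
      rw [field_eq_of_eq_zero ha h0]; linarith
  · by_contra! hneg
    have := nonneg_of_deriv_pos_of_eq_zero (h := fun s => -ζ s) hts.le
      (fun s _ => (h.deriv s).neg) (by linarith) (fun s _ h0 => by
        rw [field_eq_of_eq_zero ha (by linarith)]; linarith)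
    linarith

lemma pos_of_neg (h : IsProfile a b B r m M ζ) (ha : Admissible a b B r m M) (hb : b < 0)
    (s : ℝ) : 0 < ζ s := by
  rcases le_or_gt s (-M) with h1 | h1
  · exact h.pos_of_le ha h1
  · refine pos_of_deriv_pos_of_eq_zero h1 (fun s _ => h.deriv s)
      (h.pos_of_le ha le_rfl).le (fun s _ h0 => ?_)
    rw [field_eq_of_eq_zero ha h0]; linarith

lemma field_eq (h : IsProfile a b B r m M ζ) (ha : Admissible a b B r m M) {s : ℝ} (hs : s ≤ 0)
    (hpos : 0 ≤ ζ s) : field a b B s (ζ s) = cubic a b (s * ζ s) :=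
  field_of_mem (by linarith [h.root_le ha hs, ha.lb])
    ((mul_nonpos_of_nonpos_of_nonneg hs hpos).trans ha.B_pos.le)

lemma hasDerivAt_mul (h : IsProfile a b B r m M ζ) (ha : Admissible a b B r m M) {s : ℝ}
    (hs : s ≤ 0) (hpos : 0 ≤ ζ s) :
    HasDerivAt (fun s => s * ζ s) (ζ s + s * cubic a b (s * ζ s)) s := by
  have := (hasDerivAt_id s).mul (h.deriv s)
  rw [h.field_eq ha hs hpos] at this
  simpa [Pi.mul_def] using this

/-- `s ζ(s)` is increasing as long as `s ≤ 0` and `ζ(s) > 0`. -/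
lemma speed_pos (h : IsProfile a b B r m M ζ) (ha : Admissible a b B r m M) (hb : b ≠ 0)
    {s : ℝ} (hs : s ≤ 0) (hpos : 0 < ζ s) : 0 < ζ s + s * cubic a b (s * ζ s) := by
  rcases hs.eq_or_lt with rfl | hs
  · simpa using hpos
  by_contra! hneg
  have hp : ∀ t ≤ s, 0 < ζ t := fun t ht => h.pos_of_pos ha hb ht hpos
  have hd : ∀ t ≤ s, HasDerivAt (fun t => t * ζ t) (ζ t + t * cubic a b (t * ζ t)) t :=
    fun t ht => h.hasDerivAt_mul ha (ht.trans hs.le) (hp t ht).le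
  -- Let `E = ζ + t g(tζ)`. Where `E = 0`, `E' = 2 g(tζ)`, and `t g = -ζ < 0` forces `g > 0`. So `E`
  -- crosses zero only upwards, and `E(s) ≤ 0` implies `E ≤ 0` on all of `(-∞, s]`.
  have hall : ∀ t ≤ s, ζ t + t * cubic a b (t * ζ t) ≤ 0 := by
    intro t ht
    by_contra! hlt
    rcases ht.eq_or_lt with rfl | ht
    · linarith
    have := pos_of_deriv_pos_of_eq_zero ht (fun x hx => (h.deriv x).add
      ((hasDerivAt_id x).mul ((hasDerivAt_cubic a b _).comp x (hd x hx.2)))) hlt.le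
      (fun x hx h0 => by
        simp only [Pi.add_apply, Pi.mul_apply, id, Function.comp_apply] at h0
        have hx0 : x < 0 := hx.2.trans_lt hs
        have hg : 0 < cubic a b (x * ζ x) := by
          by_contra! hg
          have := mul_nonneg_of_nonpos_of_nonpos hx0.le hg
          linarith [hp x hx.2]
        simp only [Function.comp_apply, id]
        rw [h.field_eq ha hx0.le (hp x hx.2).le, h0]
        linarith)
    simp only [Pi.add_apply, Pi.mul_apply, id, Function.comp_apply] at this
    linarith
  -- Then `tζ(t)` decreases from its limit `r`, so `sζ(s) = r`; there `g = 0` and `E = ζ > 0`, a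
  -- contradiction.
  have hanti : AntitoneOn (fun t => t * ζ t) (Set.Iic s) :=
    antitoneOn_of_deriv_nonpos (convex_Iic s)
      (fun t ht => (hd t ht).continuousAt.continuousWithinAt)
      (fun t ht => by
        rw [interior_Iic] at ht
        exact (hd t (le_of_lt ht)).differentiableAt.differentiableWithinAt)
      (fun t ht => by
        rw [interior_Iic] at ht
        rw [(hd t (le_of_lt ht)).deriv]; exact hall t (le_of_lt ht))
  have hle : s * ζ s ≤ r := ge_of_tendsto (h.tendsto_mul ha)
    ((eventually_le_atBot s).mono fun t ht => hanti ht Set.self_mem_Iic ht)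
  have heq : s * ζ s = r := le_antisymm hle (h.root_le ha hs.le)
  rw [heq, ha.root] at hneg
  linarith

lemma strictMonoOn_mul (h : IsProfile a b B r m M ζ) (ha : Admissible a b B r m M) (hb : b ≠ 0)
    {s : ℝ} (hs : s ≤ 0) (hpos : 0 < ζ s) : StrictMonoOn (fun s => s * ζ s) (Set.Iic s) := by
  have hp : ∀ t ≤ s, 0 < ζ t := fun t ht => h.pos_of_pos ha hb ht hpos
  refine strictMonoOn_of_deriv_pos (convex_Iic s)
    ((continuous_id.mul h.continuous).continuousOn) fun t ht => ?_
  rw [interior_Iic] at ht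
  have ht' : t ≤ s := le_of_lt ht
  rw [(h.hasDerivAt_mul ha (ht'.trans hs) (hp t ht').le).deriv]
  exact h.speed_pos ha hb (ht'.trans hs) (hp t ht')

lemma root_lt (h : IsProfile a b B r m M ζ) (ha : Admissible a b B r m M) (hb : b ≠ 0)
    {s : ℝ} (hs : s ≤ 0) (hpos : 0 < ζ s) : r < s * ζ s := by
  refine (h.root_le ha (s := s - 1) (by linarith)).trans_lt ?_
  exact h.strictMonoOn_mul ha hb hs hpos (by simp) (by simp) (by linarith)

/-- Every value in `(r, 0)` is attained by `s ζ(s)` with `s < 0`. -/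
lemma exists_mul_eq (h : IsProfile a b B r m M ζ) (ha : Admissible a b B r m M) {v : ℝ}
    (hrv : r < v) (hv : v < 0) : ∃ s < 0, s * ζ s = v := by
  obtain ⟨t, ht, htv⟩ := ((eventually_lt_atBot 0).and
    ((h.tendsto_mul ha).eventually (gt_mem_nhds hrv))).exists
  obtain ⟨s, hs, hsv⟩ := intermediate_value_Icc ht.le (f := fun s => s * ζ s)
    ((continuous_id.mul h.continuous).continuousOn) ⟨htv.le, by simpa using hv.le⟩
  refine ⟨s, lt_of_le_of_ne hs.2 ?_, hsv⟩
  rintro rfl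
  simp at hsv
  exact hv.ne hsv.symm


end IsProfile

/-! ### Dependence of profiles on the parameter -/

/-- Homogeneity lets `|a' - a|` factor out, so that the Gronwall constant is independent of `a'`. -/
lemma gronwallBound_mul (t δ K ε x : ℝ) :
    gronwallBound (t * δ) K (t * ε) x = t * gronwallBound δ K ε x := by
  unfold gronwallBound
  split_ifs <;> ring

/-- On `s ≤ 0` profiles depend Lipschitz continuously on the parameter `a`. -/
lemma exists_abs_sub_le {a b B r m M : ℝ} (ha : Admissible a b B r m M) {ζ : ℝ → ℝ}
    (h : IsProfile a b B r m M ζ) :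
    ∃ C, ∀ a' r' ζ', Admissible a' b B r' m M → IsProfile a' b B r' m M ζ' →
      ∀ s ≤ 0, |ζ' s - ζ s| ≤ |a' - a| * C := by
  have hB := ha.B_pos.le
  have hM := ha.pos
  have hc := cubicDeriv_pos ha.neg ha.slope
  set δ := B ^ 2 / (cubicDeriv a m * M) with hδ
  have hδ0 : 0 ≤ δ := by positivity
  set K := Real.toNNReal (lipConst a B * M)
  refine ⟨gronwallBound δ K (B ^ 2) M, fun a' r' ζ' ha' h' => ?_⟩
  have hleft : ∀ s ≤ -M, |ζ' s - ζ s| ≤ |a' - a| * δ := fun s hs => by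
    have := h.sub_le h' ha.slope ha.neg le_rfl ha.pos ha.lb.le ha'.lb.le hc le_rfl s hs
    rw [mul_div_assoc, abs_sub_comm a a'] at this
    exact abs_le.2 ⟨by linarith [this.1], this.2⟩
  intro s hs
  have hmono := gronwallBound_mono hδ0 (sq_nonneg B) K.2
  rcases le_or_gt s (-M) with hsM | hsM
  · refine (hleft s hsM).trans (mul_le_mul_of_nonneg_left ?_ (abs_nonneg _))
    have := hmono hM.le
    rwa [gronwallBound_x0] at this
  · have key := dist_le_of_approx_trajectories_ODE_of_mem (v := field a b B)
      (s := fun _ => Set.univ) (K := K) (a := -M) (b := 0) (f := ζ') (g := ζ)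
      (f' := fun s => field a' b B s (ζ' s)) (g' := fun s => field a b B s (ζ s))
      (εf := |a' - a| * B ^ 2) (εg := 0) (δ := |a' - a| * δ)
      (fun t ht => LipschitzOnWith.of_dist_le_mul fun X _ Y _ => by
        rw [Real.dist_eq, Real.dist_eq,
          Real.coe_toNNReal _ (mul_nonneg (lipConst_nonneg hB) hM.le)]
        refine (abs_field_sub_le hB _ _ _).trans ?_
        have := lipConst_nonneg (a := a) hB
        have : |t| ≤ M := abs_le.2 ⟨ht.1, ht.2.le.trans hM.le⟩
        gcongr)
      h'.continuous.continuousOn (fun t _ => (h'.deriv t).hasDerivWithinAt)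
      (fun t _ => abs_field_sub_field_le hB _ _) (fun _ _ => trivial)
      h.continuous.continuousOn (fun t _ => (h.deriv t).hasDerivWithinAt)
      (fun t _ => by simp) (fun _ _ => trivial) (hleft _ le_rfl) s ⟨hsM.le, hs⟩
    rw [add_zero, gronwallBound_mul] at key
    exact key.trans (mul_le_mul_of_nonneg_left (hmono (by linarith)) (abs_nonneg _))

/-! ### Trajectories of the planar system -/

/-- `(v, z)` solves `v' = v g(v) + z²`, `z' = z g(v)` with `g = cubic a b` on `I`. -/
def IsTrajectory (a b : ℝ) (v z : ℝ → ℝ) (I : Set ℝ) : Prop :=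
  ∀ τ ∈ I, HasDerivAt v (v τ * cubic a b (v τ) + z τ ^ 2) τ ∧
    HasDerivAt z (z τ * cubic a b (v τ)) τ

/-- The points on trajectories with `z > 0` that tend to `(r, 0)` as `τ → -∞`. -/
def unstableSet (a b r : ℝ) : Set (ℝ × ℝ) :=
  {p | ∃ (v z : ℝ → ℝ) (T : ℝ), IsTrajectory a b v z (Set.Iio T) ∧ (∀ τ < T, 0 < z τ) ∧
    Tendsto v atBot (𝓝 r) ∧ Tendsto z atBot (𝓝 0) ∧ ∃ τ < T, (v τ, z τ) = p}

/-- The part of the trajectory through `q` on the maximal time interval with `v' > 0`. -/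
def risingArc (a b : ℝ) (q : ℝ × ℝ) : Set (ℝ × ℝ) :=
  {p | ∃ (v z : ℝ → ℝ) (x y : ℝ), x < 0 ∧ 0 < y ∧ IsTrajectory a b v z (Set.Ioo x y) ∧
    (v 0, z 0) = q ∧ (∀ τ ∈ Set.Ioo x y, 0 < v τ * cubic a b (v τ) + z τ ^ 2) ∧
    ∃ τ ∈ Set.Ioo x y, (v τ, z τ) = p}

namespace IsTrajectory

variable {a b : ℝ} {v z : ℝ → ℝ} {I : Set ℝ}

/-- The quotient `w = v / z` satisfies `w' = z`. -/
lemma hasDerivAt_div (h : IsTrajectory a b v z I) {τ : ℝ} (hτ : τ ∈ I) (hz : 0 < z τ) :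
    HasDerivAt (fun τ => v τ / z τ) (z τ) τ := by
  refine ((h τ hτ).1.div (h τ hτ).2 hz.ne').congr_deriv ?_
  field_simp
  ring

/-- The level `K` is crossed upwards if `K g(K) ≥ 0` and `z > 0`. -/
lemma le_of_le (h : IsTrajectory a b v z I) {K x y : ℝ} (hK : 0 ≤ K * cubic a b K) (hxy : x ≤ y)
    (hI : Set.Icc x y ⊆ I) (hz : ∀ t ∈ Set.Icc x y, 0 < z t) (hx : K ≤ v x) : K ≤ v y := by
  have := nonneg_of_deriv_pos_of_eq_zero (h := fun t => v t - K) hxy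
    (fun t ht => (h t (hI ht)).1.sub_const K) (by linarith) (fun t ht h0 => by
      rw [show v t = K by linarith]
      have := hz t ht
      positivity)
  linarith

lemma lt_of_le (h : IsTrajectory a b v z I) {K x y : ℝ} (hK : 0 ≤ K * cubic a b K) (hxy : x < y)
    (hI : Set.Icc x y ⊆ I) (hz : ∀ t ∈ Set.Icc x y, 0 < z t) (hx : K ≤ v x) : K < v y := by
  have := pos_of_deriv_pos_of_eq_zero (h := fun t => v t - K) hxy
    (fun t ht => (h t (hI ht)).1.sub_const K) (by linarith) (fun t ht h0 => by
      rw [show v t = K by linarith]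
      have := hz t ht
      positivity)
  linarith

/-- A trajectory in the upper half plane which meets the graph of a solution of the slope equation
stays on it. -/
lemma eq_of_eq (h : IsTrajectory a b v z I) {B x y t₀ : ℝ} (hB : 0 ≤ B) {ζ : ℝ → ℝ}
    (hζ : ∀ s, HasDerivAt ζ (field a b B s (ζ s)) s) (hI : Set.Icc x y ⊆ I)
    (hz : ∀ t ∈ Set.Icc x y, 0 < z t) (hv : ∀ t ∈ Set.Icc x y, -B ≤ v t ∧ v t ≤ B)
    (ht₀ : t₀ ∈ Set.Icc x y) (h0 : z t₀ = ζ (v t₀ / z t₀)) :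
    ∀ t ∈ Set.Icc x y, z t = ζ (v t / z t) := by
  have := eq_zero_of_abs_deriv_le (h := fun t => z t - ζ (v t / z t)) (K := lipConst a B * B) ht₀
    (fun t ht => (h t (hI ht)).2.sub
      ((hζ _).comp t (h.hasDerivAt_div (hI ht) (hz t ht)))) (fun t ht => by
      have hzt := hz t ht
      have hw : v t / z t * z t = v t := div_mul_cancel₀ _ hzt.ne'
      have e : z t * cubic a b (v t) - field a b B (v t / z t) (ζ (v t / z t)) * z t =
          z t * (field a b B (v t / z t) (z t) - field a b B (v t / z t) (ζ (v t / z t))) := by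
        rw [field_of_mem (Z := z t) (by rw [hw]; exact (hv t ht).1)
          (by rw [hw]; exact (hv t ht).2), hw]
        ring
      rw [e, abs_mul, abs_of_pos hzt]
      have h1 := abs_field_sub_le (a := a) (b := b) hB (v t / z t) (z t) (ζ (v t / z t))
      have h2 : z t * |v t / z t| = |v t| := by
        -- The factor `z` from `w' = z` cancels the denominator of `v / z`, so the Lipschitz
        -- constant is uniform however small `z` is.
        rw [abs_div, abs_of_pos hzt, mul_div_cancel₀ _ hzt.ne']
      calc _ ≤ z t * (lipConst a B * |v t / z t| * |z t - ζ (v t / z t)|) :=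
            mul_le_mul_of_nonneg_left h1 hzt.le
        _ = lipConst a B * (z t * |v t / z t|) * |z t - ζ (v t / z t)| := by ring
        _ ≤ _ := by
          rw [h2]
          have := lipConst_nonneg (a := a) hB
          have := abs_le.2 (hv t ht)
          gcongr) (by simp only [← h0, sub_self])
  intro t ht
  exact sub_eq_zero.1 (this t ht)

/-- Trajectories do not leave the upper half plane. -/
lemma pos_of_pos (h : IsTrajectory a b v z I) (hI : I.OrdConnected) {t₀ : ℝ} (ht₀ : t₀ ∈ I)
    (h0 : 0 < z t₀) : ∀ t ∈ I, 0 < z t := by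
  intro t ht
  by_contra! hneg
  have hsub : Set.uIcc t t₀ ⊆ I := hI.uIcc_subset ht ht₀
  have hcz : ContinuousOn z (Set.uIcc t t₀) := fun s hs =>
    (h s (hsub hs)).2.continuousAt.continuousWithinAt
  have hcv : ContinuousOn (fun s => cubic a b (v s)) (Set.uIcc t t₀) := fun s hs =>
    ((continuous_cubic a b).continuousAt.comp (h s (hsub hs)).1.continuousAt).continuousWithinAt
  obtain ⟨s, hs, hs0⟩ := intermediate_value_uIcc hcz (Set.mem_uIcc.2 (Or.inl ⟨hneg, h0.le⟩))
  obtain ⟨K, hK⟩ := isCompact_uIcc.exists_bound_of_continuousOn hcv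
  have := eq_zero_of_abs_deriv_le (h := z) (K := K) (x := min t t₀) (y := max t t₀) hs
    (fun s hs => (h s (hsub hs)).2) (fun s hs => by
      rw [abs_mul, mul_comm]
      exact mul_le_mul_of_nonneg_right (hK s hs) (abs_nonneg _)) hs0 t₀
    ⟨min_le_right _ _, le_max_right _ _⟩
  linarith

end IsTrajectory

/-! ### Trajectories from the equilibrium lie on the profile -/

namespace IsProfile

variable {a b B r m M : ℝ} {ζ : ℝ → ℝ}

/-- Trajectories emanating from `(r, 0)` lie on the profile. -/
lemma eq_of_tendsto (h : IsProfile a b B r m M ζ) (ha : Admissible a b B r m M)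
    {v z : ℝ → ℝ} {T τ K : ℝ} (ht : IsTrajectory a b v z (Set.Iio T)) (hz : ∀ t < T, 0 < z t)
    (hv : Tendsto v atBot (𝓝 r)) (hz0 : Tendsto z atBot (𝓝 0)) (hτ : τ < T)
    (hK : 0 ≤ K * cubic a b K) (hKB : K ≤ B) (hτK : v τ ≤ K) :
    r ≤ v τ ∧ z τ = ζ (v τ / z τ) := by
  -- The level `K` is crossed only upwards, so going backwards `v` never exceeds it.
  have hvK : ∀ t ≤ τ, v t ≤ K := by
    intro t hle
    by_contra! hlt
    rcases hle.eq_or_lt with rfl | hle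
    · linarith
    have := ht.lt_of_le hK hle (fun s hs => hs.2.trans_lt hτ)
      (fun s hs => hz s (hs.2.trans_lt hτ)) hlt.le
    linarith
  have hzinv : Tendsto (fun t => (z t)⁻¹) atBot atTop :=
    tendsto_inv_nhdsGT_zero.comp (tendsto_nhdsWithin_iff.2
      ⟨hz0, (eventually_lt_atBot T).mono fun t ht => hz t ht⟩)
  have hw : Tendsto (fun t => v t / z t) atBot atBot := by
    simp only [div_eq_mul_inv]
    exact hv.neg_mul_atTop ha.r_neg hzinv
  obtain ⟨T₁, hT₁⟩ := eventually_atBot.1 (((hw.eventually_le_atBot (-M)).and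
    (hv.eventually (gt_mem_nhds ha.lt))).and ((hv.eventually (lt_mem_nhds ha.lb)).and
    (eventually_le_atBot τ)))
  have hT : ∀ t ≤ T₁, t < T := fun t h1 => (hT₁ t h1).2.2.trans_lt hτ
  have hwz : ∀ t < T, v t / z t * z t = v t := fun t h1 => div_mul_cancel₀ _ (hz t h1).ne'
  have hD : Tendsto (fun t => z t - ζ (v t / z t)) atBot (𝓝 0) := by
    simpa using hz0.sub (h.tendsto_zero.comp hw)
  have hfield : ∀ t ≤ T₁, field a b B (v t / z t) (ζ (v t / z t)) =
      cubic a b (v t / z t * ζ (v t / z t)) := fun t h1 =>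
    h.field_eq ha (by linarith [(hT₁ t h1).1.1, ha.pos]) (h.pos_of_le ha (hT₁ t h1).1.1).le
  have hd : ∀ t ≤ T₁, HasDerivAt (fun t => z t - ζ (v t / z t))
      (z t * cubic a b (v t) - cubic a b (v t / z t * ζ (v t / z t)) * z t) t := fun t h1 => by
    rw [← hfield t h1]
    exact (ht t (hT t h1)).2.sub
      ((h.deriv _).comp t (ht.hasDerivAt_div (hT t h1) (hz t (hT t h1))))
  have hd' : ∀ t ≤ T₁, HasDerivAt (fun t => -(z t - ζ (v t / z t)))
      (-(z t * cubic a b (v t) - cubic a b (v t / z t * ζ (v t / z t)) * z t)) t :=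
    fun t h1 => (hd t h1).neg
  -- If `z > ζ(w)` with `w = v / z < 0`, then `v = wz ≤ wζ(w)`. Monotonicity of the cubic makes `z -
  -- ζ(w)` nonincreasing there; it tends to `0` at `-∞`, so it is never positive. The other sign is
  -- symmetric.
  have hle₁ := le_of_deriv_nonpos_of_tendsto le_rfl hd (fun t h1 hlt => by
    have hzt := hz t (hT t h1)
    have hwneg : v t / z t ≤ 0 := by linarith [(hT₁ t h1).1.1, ha.pos]
    have h2 : v t ≤ v t / z t * ζ (v t / z t) := by
      conv_lhs => rw [← hwz t (hT t h1)]
      exact mul_le_mul_of_nonpos_left (by linarith) hwneg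
    have h3 := cubic_le_cubic (b := b) ha.neg ha.slope h2 (h.mem _ (hT₁ t h1).1.1).2
    nlinarith) hD
  have hle₂ := le_of_deriv_nonpos_of_tendsto le_rfl hd' (fun t h1 hlt => by
    have hzt := hz t (hT t h1)
    have hwneg : v t / z t ≤ 0 := by linarith [(hT₁ t h1).1.1, ha.pos]
    have h2 : v t / z t * ζ (v t / z t) ≤ v t := by
      conv_rhs => rw [← hwz t (hT t h1)]
      exact mul_le_mul_of_nonpos_left (by linarith) hwneg
    have h3 := cubic_le_cubic (b := b) ha.neg ha.slope h2 (hT₁ t h1).1.2.le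
    nlinarith) (by simpa using hD.neg)
  have heq : z T₁ = ζ (v T₁ / z T₁) := by
    linarith [hle₁ T₁ le_rfl, hle₂ T₁ le_rfl]
  have hT₁τ := (hT₁ T₁ le_rfl).2.2
  have hr₁ : r ≤ v T₁ := by
    have := h.root_le ha (s := v T₁ / z T₁) (by linarith [(hT₁ T₁ le_rfl).1.1, ha.pos])
    rwa [← heq, hwz T₁ (hT T₁ le_rfl)] at this
  have hrv : ∀ t ∈ Set.Icc T₁ τ, r ≤ v t := fun t hmem =>
    ht.le_of_le (by rw [ha.root, mul_zero]) hmem.1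
      (fun s hs => (hs.2.trans hmem.2).trans_lt hτ)
      (fun s hs => hz s ((hs.2.trans hmem.2).trans_lt hτ)) hr₁
  refine ⟨hrv τ ⟨hT₁τ, le_rfl⟩, ht.eq_of_eq ha.B_pos.le h.deriv (fun s hs => hs.2.trans_lt hτ)
    (fun s hs => hz s (hs.2.trans_lt hτ)) (fun s hs => ⟨by linarith [hrv s hs, ha.lb],
      (hvK s hs.2).trans hKB⟩) ⟨le_rfl, hT₁τ⟩ heq τ ⟨hT₁τ, le_rfl⟩⟩

/-- The rising arc through a point of the unstable set lies on the profile. -/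
lemma eq_of_mem_risingArc (h : IsProfile a b B r m M ζ) (ha : Admissible a b B r m M)
    {K : ℝ} (hK : 0 ≤ K * cubic a b K) (hKB : K ≤ B) {p q : ℝ × ℝ}
    (hq : q ∈ unstableSet a b r) (hqK : q.1 ≤ K) (hp : p ∈ risingArc a b q) (hp0 : p.1 ≤ 0) :
    0 < p.2 ∧ p.2 = ζ (p.1 / p.2) := by
  obtain ⟨v₁, z₁, T, ht₁, hz₁, hv₁, hz₁0, τ₁, hτ₁, rfl⟩ := hq
  obtain ⟨hrq, hqζ⟩ := h.eq_of_tendsto ha ht₁ hz₁ hv₁ hz₁0 hτ₁ hK hKB hqK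
  have hqpos := hz₁ τ₁ hτ₁
  obtain ⟨v, z, x, y, hx, hy, ht, hq, hspeed, τ, hτ, rfl⟩ := hp
  obtain ⟨hvq, hzq⟩ := Prod.mk.inj hq
  simp only at hqK hp0 ⊢
  rw [← hvq, ← hzq] at hqζ
  rw [← hvq] at hrq hqK
  rw [← hzq] at hqpos
  have h00 : (0 : ℝ) ∈ Set.Ioo x y := ⟨hx, hy⟩
  have hz := ht.pos_of_pos Set.ordConnected_Ioo h00 hqpos
  have hmono : StrictMonoOn v (Set.Ioo x y) := by
    refine strictMonoOn_of_deriv_pos (convex_Ioo x y)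
      (fun t h1 => (ht t h1).1.continuousAt.continuousWithinAt) fun t h1 => ?_
    rw [interior_Ioo] at h1
    rw [(ht t h1).1.deriv]
    exact hspeed t h1
  have hB := ha.B_pos.le
  refine ⟨hz τ hτ, ?_⟩
  rcases le_total 0 τ with h0τ | hτ0
  · have hsub : Set.Icc 0 τ ⊆ Set.Ioo x y := Set.ordConnected_Ioo.out h00 hτ
    refine ht.eq_of_eq hB h.deriv hsub (fun s hs => hz s (hsub hs)) (fun s hs => ⟨?_, ?_⟩)
      ⟨le_rfl, h0τ⟩ hqζ τ ⟨h0τ, le_rfl⟩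
    · linarith [hmono.monotoneOn h00 (hsub hs) hs.1, ha.lb]
    · linarith [hmono.monotoneOn (hsub hs) hτ hs.2]
  · have hsub : Set.Icc τ 0 ⊆ Set.Ioo x y := Set.ordConnected_Ioo.out hτ h00
    have key : ∀ t ∈ Set.Icc τ 0, -B ≤ v t → z t = ζ (v t / z t) := fun t h1 hBt => by
      have hsub' : Set.Icc t 0 ⊆ Set.Ioo x y := (Set.Icc_subset_Icc_left h1.1).trans hsub
      exact ht.eq_of_eq hB h.deriv hsub' (fun s hs => hz s (hsub' hs))
        (fun s hs => ⟨hBt.trans (hmono.monotoneOn (hsub h1) (hsub' hs) hs.1),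
          ((hmono.monotoneOn (hsub' hs) h00 hs.2).trans hqK).trans hKB⟩) ⟨h1.2, le_rfl⟩ hqζ t
        ⟨le_rfl, h1.2⟩
    rcases le_or_gt (-B) (v τ) with hBτ | hBτ
    · exact key τ ⟨le_rfl, hτ0⟩ hBτ
    -- Truncation cannot become active: at a time with `v = -B` the arc would still lie on the
    -- profile, where `v ≥ r > -B`.
    · obtain ⟨t, h1, hvt⟩ := intermediate_value_Icc hτ0
        (fun t h1 => (ht t (hsub h1)).1.continuousAt.continuousWithinAt : ContinuousOn v _)
        (show -B ∈ Set.Icc (v τ) (v 0) from ⟨hBτ.le, by linarith [ha.lb]⟩)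
      have hzt := hz t (hsub h1)
      have h2 := h.root_le ha (s := v t / z t)
        (div_nonpos_of_nonpos_of_nonneg (by linarith) hzt.le)
      rw [← key t h1 hvt.ge, div_mul_cancel₀ _ hzt.ne'] at h2
      linarith [ha.lb]

end IsProfile

/-- A differentiable function on `ℝ` whose derivative is continuous and at least `c > 0` has a
global differentiable inverse. -/
lemma exists_inverse_of_le_deriv {ρ : ℝ → ℝ} (hρ : Continuous ρ) {c : ℝ} (hc : 0 < c)
    (hle : ∀ s, c ≤ ρ s) :
    ∃ θ : ℝ ≃o ℝ, ∀ τ, HasDerivAt θ.symm (ρ (θ.symm τ))⁻¹ τ := by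
  set F : ℝ → ℝ := fun s => ∫ x in (0 : ℝ)..s, ρ x with hF
  have hd : ∀ s, HasDerivAt F (ρ s) s := fun s => hρ.integral_hasStrictDerivAt 0 s |>.hasDerivAt
  have hcont : Continuous F := continuous_iff_continuousAt.2 fun s => (hd s).continuousAt
  have hmono : StrictMono F := strictMono_of_deriv_pos fun s => by
    rw [(hd s).deriv]; exact hc.trans_le (hle s)
  have hF0 : F 0 = 0 := by simp [hF]
  have hG : Monotone fun s => F s - c * s := monotone_of_deriv_nonneg
    (fun s => ((hd s).sub ((hasDerivAt_id s).const_mul c)).differentiableAt) fun s => by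
      have h1 : HasDerivAt (fun s => F s - c * s) (ρ s - c * 1) s :=
        (hd s).sub ((hasDerivAt_id s).const_mul c)
      rw [h1.deriv]; linarith [hle s]
  have htop : Tendsto F atTop atTop := tendsto_atTop_mono' _
    ((eventually_ge_atTop 0).mono fun s hs => by
      have := hG hs
      simp only [hF0] at this
      simp only [id]
      linarith) (tendsto_id.const_mul_atTop hc)
  have hbot : Tendsto F atBot atBot := tendsto_atBot_mono' _
    ((eventually_le_atBot 0).mono fun s hs => by
      have := hG hs
      simp only [hF0] at this
      simp only [id]
      linarith) (tendsto_id.const_mul_atBot hc)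
  refine ⟨hmono.orderIsoOfSurjective F (hcont.surjective htop hbot), fun τ => ?_⟩
  set θ := hmono.orderIsoOfSurjective F (hcont.surjective htop hbot)
  exact HasDerivAt.of_local_left_inverse (f := F) θ.symm.continuous.continuousAt (hd _)
    (hc.trans_le (hle _)).ne' (Eventually.of_forall fun y => θ.apply_symm_apply y)

namespace IsProfile

variable {a b B r m M : ℝ} {ζ : ℝ → ℝ}

/-- The graph of a positive profile consists of points of the unstable set on one rising arc. -/
lemma mem_unstableSet_and_mem_risingArc (h : IsProfile a b B r m M ζ)
    (ha : Admissible a b B r m M) (hb : b ≠ 0) {s₀ s : ℝ} (hs₀ : s₀ ≤ 0) (hpos : 0 < ζ s₀)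
    (hs : s ≤ s₀) :
    (s * ζ s, ζ s) ∈ unstableSet a b r ∧ (s₀ * ζ s₀, ζ s₀) ∈ risingArc a b (s * ζ s, ζ s) := by
  set P : ℝ → Prop := fun t => 0 < ζ t ∧ -B ≤ t * ζ t ∧ t * ζ t ≤ B ∧
    0 < ζ t + t * cubic a b (t * ζ t) with hP
  have hPle : ∀ t ≤ s₀, P t := fun t ht => by
    have h1 := h.pos_of_pos ha hb ht hpos
    have h2 := ht.trans hs₀
    exact ⟨h1, by linarith [h.root_le ha h2, ha.lb],
      (mul_nonpos_of_nonpos_of_nonneg h2 h1.le).trans ha.B_pos.le, h.speed_pos ha hb h2 h1⟩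
  have hcu : Continuous fun t => t * ζ t := continuous_id.mul h.continuous
  have hcE : Continuous fun t => ζ t + t * cubic a b (t * ζ t) :=
    h.continuous.add (continuous_id.mul ((continuous_cubic a b).comp hcu))
  have hev : ∀ᶠ t in 𝓝 s₀, P t := by
    have h1 := hPle s₀ le_rfl
    have h2 := h.root_le ha hs₀
    have h3 : s₀ * ζ s₀ < B := (mul_nonpos_of_nonpos_of_nonneg hs₀ hpos.le).trans_lt ha.B_pos
    filter_upwards [h.continuous.continuousAt.eventually (lt_mem_nhds hpos),
      hcu.continuousAt.eventually (lt_mem_nhds (ha.lb.trans_le h2)),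
      hcu.continuousAt.eventually (gt_mem_nhds h3),
      hcE.continuousAt.eventually (lt_mem_nhds h1.2.2.2)] with t k1 k2 k3 k4
    exact ⟨k1, k2.le, k3.le, k4⟩
  obtain ⟨ε, hε, hball⟩ := Metric.eventually_nhds_iff.1 hev
  -- The arc is over an open time interval, so the profile is followed slightly beyond `s₀`.
  set s₁ := s₀ + ε / 2 with hs₁
  have hPs₁ : ∀ t ≤ s₁, P t := fun t ht => by
    rcases le_or_gt t s₀ with h1 | h1
    · exact hPle t h1
    · exact hball (by rw [Real.dist_eq, abs_of_pos (by linarith)]; linarith)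
  have hζb : ∃ C, ∀ t ≤ s₁, ζ t ≤ C := by
    obtain ⟨A, hA⟩ := eventually_atBot.1 (h.tendsto_zero.eventually (gt_mem_nhds one_pos))
    obtain ⟨C, hC⟩ := (isCompact_Icc (a := A) (b := s₁)).exists_bound_of_continuousOn
      h.continuous.continuousOn
    refine ⟨max 1 C, fun t ht => ?_⟩
    rcases le_total t A with h1 | h1
    · exact (hA t h1).le.trans (le_max_left _ _)
    · exact ((le_abs_self _).trans (hC t ⟨h1, ht⟩)).trans (le_max_right _ _)
  obtain ⟨C, hC⟩ := hζb
  have hCpos : 0 < C := hpos.trans_le (hC s₀ (by linarith))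
  have hcm : Continuous fun t => ζ (min t s₁) := h.continuous.comp (by fun_prop)
  have hmpos : ∀ t, 0 < ζ (min t s₁) := fun t => (hPs₁ _ (min_le_right _ _)).1
  -- Time is recovered from `dτ/ds = 1/ζ(s)`. Freezing `ζ` beyond `s₁` keeps the integrand at least
  -- `1/C` on the whole line.
  obtain ⟨θ, hθ⟩ := exists_inverse_of_le_deriv (ρ := fun t => (ζ (min t s₁))⁻¹)
    (hcm.inv₀ fun t => (hmpos t).ne') (inv_pos.2 hCpos) fun t =>
      inv_anti₀ (hmpos t) (hC _ (min_le_right _ _))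
  simp only [inv_inv] at hθ
  have hlt : ∀ τ < θ s₁, θ.symm τ < s₁ := fun τ hτ => by
    rw [← θ.symm_apply_apply s₁]; exact θ.symm.strictMono hτ
  set V : ℝ → ℝ := fun τ => θ.symm τ * ζ (θ.symm τ) with hV
  set Z : ℝ → ℝ := fun τ => ζ (θ.symm τ) with hZ
  have htraj : IsTrajectory a b V Z (Set.Iio (θ s₁)) := fun τ hτ => by
    have h1 := hPs₁ _ (hlt τ hτ).le
    have hw := hθ τ
    rw [min_eq_left (hlt τ hτ).le] at hw
    have hz := (h.deriv _).comp τ hw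
    rw [field_of_mem h1.2.1 h1.2.2.1] at hz
    refine ⟨(hw.mul hz).congr_deriv ?_, hz.congr_deriv ?_⟩
    · simp only [hV, hZ, Function.comp_apply]; ring
    · simp only [hV, hZ]; ring
  have hbot : Tendsto θ.symm atBot atBot := θ.symm.tendsto_atBot
  have hss₁ : s < s₁ := by linarith
  constructor
  · refine ⟨V, Z, θ s₁, htraj, fun τ hτ => (hPs₁ _ (hlt τ hτ).le).1,
      (h.tendsto_mul ha).comp hbot, h.tendsto_zero.comp hbot, θ s, θ.strictMono hss₁, ?_⟩
    simp [hV, hZ]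
  · have h1 := θ.strictMono hss₁
    have hmem : ∀ τ ∈ Set.Ioo (-1) (θ s₁ - θ s), τ + θ s < θ s₁ := fun τ hτ => by
      linarith [hτ.2]
    refine ⟨fun τ => V (τ + θ s), fun τ => Z (τ + θ s), -1, θ s₁ - θ s, by norm_num,
      by linarith, fun τ hτ => ?_, by simp [hV, hZ], fun τ hτ => ?_, θ s₀ - θ s, ⟨?_, ?_⟩, ?_⟩
    · exact ⟨(htraj _ (hmem τ hτ)).1.comp_add_const τ (θ s),
        (htraj _ (hmem τ hτ)).2.comp_add_const τ (θ s)⟩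
    · have h2 := hPs₁ _ (hlt _ (hmem τ hτ)).le
      have h3 := mul_pos h2.1 h2.2.2.2
      simp only [hV, hZ]
      linarith
    · linarith [θ.monotone hs]
    · linarith [θ.strictMono (show s₀ < s₁ by linarith)]
    · simp [hV, hZ]

end IsProfile

/-! ### Heights over a given abscissa -/

/-- `G` is a set whose part over `v ≤ 0` is the part of the graph of `ζ` with `ζ > 0`, `s ≤ 0`,
in the coordinates `(v, z) = (s ζ(s), ζ(s))`. -/
structure IsProfileGraph (ζ : ℝ → ℝ) (G : Set (ℝ × ℝ)) : Prop where
  eq : ∀ p ∈ G, p.1 ≤ 0 → 0 < p.2 ∧ p.2 = ζ (p.1 / p.2)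
  mem : ∀ s ≤ 0, 0 < ζ s → (s * ζ s, ζ s) ∈ G

namespace IsProfileGraph

variable {a b B r m M : ℝ} {ζ : ℝ → ℝ} {G : Set (ℝ × ℝ)}

lemma mem_zero_iff (hG : IsProfileGraph ζ G) {z : ℝ} : (0, z) ∈ G ↔ 0 < ζ 0 ∧ z = ζ 0 := by
  constructor
  · intro h
    obtain ⟨h1, h2⟩ := hG.eq _ h le_rfl
    simp only [zero_div] at h1 h2
    exact ⟨h2 ▸ h1, h2⟩
  · rintro ⟨h1, rfl⟩
    simpa using hG.mem 0 le_rfl h1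

lemma pos_of_mul_neg {s : ℝ} (hs : s < 0) (h : s * ζ s < 0) : 0 < ζ s := by
  by_contra! hneg
  linarith [mul_nonneg_of_nonpos_of_nonpos hs.le hneg]

lemma mem_iff (hG : IsProfileGraph ζ G) (h : IsProfile a b B r m M ζ)
    (ha : Admissible a b B r m M) (hb : b ≠ 0) {s v z : ℝ} (hs : s < 0) (hv : v < 0)
    (hsv : s * ζ s = v) : (v, z) ∈ G ↔ z = ζ s := by
  have hζs := pos_of_mul_neg hs (hsv ▸ hv)
  constructor
  · intro hz
    obtain ⟨h1, h2⟩ := hG.eq _ hz hv.le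
    simp only at h1 h2
    have ht : v / z < 0 := div_neg_of_neg_of_pos hv h1
    have htv : v / z * ζ (v / z) = v := by rw [← h2, div_mul_cancel₀ _ h1.ne']
    have heq : v / z = s := by
      rcases le_total (v / z) s with hle | hle
      · exact (h.strictMonoOn_mul ha hb hs.le hζs).injOn hle Set.self_mem_Iic
          (htv.trans hsv.symm)
      · exact (h.strictMonoOn_mul ha hb ht.le (h2 ▸ h1)).injOn Set.self_mem_Iic hle
          (htv.trans hsv.symm)
    rw [h2, heq]
  · rintro rfl
    rw [← hsv]
    exact hG.mem s hs.le hζs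

lemma root_lt (hG : IsProfileGraph ζ G) (h : IsProfile a b B r m M ζ)
    (ha : Admissible a b B r m M) (hb : b ≠ 0) {p : ℝ × ℝ} (hp : p ∈ G) (hp0 : p.1 ≤ 0) :
    r < p.1 := by
  obtain ⟨h1, h2⟩ := hG.eq p hp hp0
  have := h.root_lt ha hb (div_nonpos_of_nonpos_of_nonneg hp0 h1.le) (h2 ▸ h1)
  rwa [← h2, div_mul_cancel₀ _ h1.ne'] at this

/-- If the profile is not positive at `0`, the heights tend to zero at `0`. -/
lemma tendsto_zero (hG : IsProfileGraph ζ G) (hc : Continuous ζ) (h0 : ζ 0 ≤ 0) {φ : ℝ → ℝ}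
    (hr : r < 0) (hφ : ∀ w ∈ Set.Ioo r 0, (w, φ w) ∈ G) : Tendsto φ (𝓝[<] 0) (𝓝 0) := by
  rw [Metric.tendsto_nhds]
  intro ε hε
  obtain ⟨δ, hδ, hball⟩ := Metric.eventually_nhds_iff.1
    (hc.continuousAt.eventually (gt_mem_nhds (h0.trans_lt hε)))
  filter_upwards [Ioo_mem_nhdsLT hr, Ioo_mem_nhdsLT (show -(δ * ε) < 0 by
    have := mul_pos hδ hε; linarith)] with w hw hwδ
  obtain ⟨h1, h2⟩ := hG.eq _ (hφ w hw) hw.2.le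
  simp only at h1 h2
  rw [Real.dist_eq, sub_zero, abs_of_pos h1]
  by_contra! hle
  -- A height at least `ε` over a small `w` makes `w / φ w` close to `0`, where `ζ < ε`.
  have hlt : dist (w / φ w) 0 < δ := by
    rw [Real.dist_eq, sub_zero, abs_div, abs_of_pos h1, abs_of_neg hw.2, div_lt_iff₀ h1]
    have := mul_le_mul_of_nonneg_left hle hδ.le
    linarith [hwδ.1]
  have := hball hlt
  linarith

end IsProfileGraph

/-- Uniform convergence of profiles on `s ≤ 0` under variation of the parameter. -/
lemma eventually_abs_sub_lt {b B m M α₀ : ℝ} {A R : ℝ → ℝ} {Z : ℝ → ℝ → ℝ}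
    (hA : ContinuousAt A α₀) (hadm : ∀ᶠ α in 𝓝 α₀, Admissible (A α) b B (R α) m M)
    (hZ : ∀ᶠ α in 𝓝 α₀, IsProfile (A α) b B (R α) m M (Z α)) {ε : ℝ} (hε : 0 < ε) :
    ∀ᶠ α in 𝓝 α₀, ∀ s ≤ 0, |Z α s - Z α₀ s| < ε := by
  obtain ⟨C, hC⟩ := exists_abs_sub_le hadm.self_of_nhds hZ.self_of_nhds
  have hlim : Tendsto (fun α => |A α - A α₀| * C) (𝓝 α₀) (𝓝 0) := by
    have : Tendsto (fun α => |A α - A α₀| * C) (𝓝 α₀) (𝓝 (|A α₀ - A α₀| * C)) :=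
      ((hA.sub continuousAt_const).abs).mul continuousAt_const
    simpa using this
  filter_upwards [hadm, hZ, hlim.eventually (gt_mem_nhds hε)] with α h1 h2 h3 s hs
  exact (hC _ _ _ h1 h2 s hs).trans_lt h3

/-- The height over a fixed abscissa `v < 0` depends continuously on the parameter. -/
lemma continuousAt_height {b B m M α₀ v : ℝ} {A R : ℝ → ℝ} {Z : ℝ → ℝ → ℝ} {φ : ℝ → ℝ}
    (hb : b ≠ 0)
    (hA : ContinuousAt A α₀) (hadm : ∀ᶠ α in 𝓝 α₀, Admissible (A α) b B (R α) m M)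
    (hZ : ∀ᶠ α in 𝓝 α₀, IsProfile (A α) b B (R α) m M (Z α)) (hRv : R α₀ < v) (hv : v < 0)
    (hφ : ∀ᶠ α in 𝓝 α₀, ∀ s < 0, s * Z α s = v → φ α = Z α s) : ContinuousAt φ α₀ := by
  have ha₀ := hadm.self_of_nhds
  have h₀ := hZ.self_of_nhds
  obtain ⟨s₀, hs₀, hsv⟩ := h₀.exists_mul_eq ha₀ hRv hv
  have hpos := IsProfileGraph.pos_of_mul_neg hs₀ (hsv ▸ hv)
  have hφ₀ := hφ.self_of_nhds s₀ hs₀ hsv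
  have hconv : ∀ s ≤ 0, Tendsto (fun α => s * Z α s) (𝓝 α₀) (𝓝 (s * Z α₀ s)) := fun s hs => by
    refine Tendsto.const_mul s (Metric.tendsto_nhds.2 fun ε hε => ?_)
    exact (eventually_abs_sub_lt hA hadm hZ hε).mono fun α h => h s hs
  rw [ContinuousAt, hφ₀, Metric.tendsto_nhds]
  intro ε hε
  have hev : ∀ᶠ s in 𝓝 s₀, dist (Z α₀ s) (Z α₀ s₀) < ε / 2 ∧ 0 < Z α₀ s ∧ s < 0 :=
    ((Metric.tendsto_nhds.1 h₀.continuous.continuousAt _ (half_pos hε))).and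
      ((h₀.continuous.continuousAt.eventually (lt_mem_nhds hpos)).and (gt_mem_nhds hs₀))
  obtain ⟨δ, hδ, hball⟩ := Metric.eventually_nhds_iff.1 hev
  have hmem : ∀ s ∈ Set.Icc (s₀ - δ / 2) (s₀ + δ / 2),
      dist (Z α₀ s) (Z α₀ s₀) < ε / 2 ∧ 0 < Z α₀ s ∧ s < 0 := fun s hs => hball (by
    rw [Real.dist_eq, abs_lt]; constructor <;> linarith [hs.1, hs.2])
  have hp := hmem (s₀ + δ / 2) ⟨by linarith, le_rfl⟩
  have hm := hmem (s₀ - δ / 2) ⟨le_rfl, by linarith⟩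
  have hmono := h₀.strictMonoOn_mul ha₀ hb hp.2.2.le hp.2.1
  have h1 : (s₀ - δ / 2) * Z α₀ (s₀ - δ / 2) < v := by
    rw [← hsv]
    exact hmono (Set.mem_Iic.2 (by linarith)) (Set.mem_Iic.2 (by linarith)) (by linarith)
  have h2 : v < (s₀ + δ / 2) * Z α₀ (s₀ + δ / 2) := by
    rw [← hsv]
    exact hmono (Set.mem_Iic.2 (by linarith)) (Set.mem_Iic.2 (by linarith)) (by linarith)
  -- For nearby parameters `s Z α s` still straddles `v` at the ends `s₀ ± δ/2`, which locates the
  -- new solution `s` near `s₀`.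
  filter_upwards [hφ, hZ, (hconv _ hm.2.2.le).eventually (gt_mem_nhds h1),
    (hconv _ hp.2.2.le).eventually (lt_mem_nhds h2),
    eventually_abs_sub_lt hA hadm hZ (half_pos hε)] with α hφα hZα k1 k2 k3
  obtain ⟨s, hs, hsα⟩ := intermediate_value_Icc (by linarith : s₀ - δ / 2 ≤ s₀ + δ / 2)
    (f := fun s => s * Z α s) (continuous_id.mul hZα.continuous).continuousOn ⟨k1.le, k2.le⟩
  have hs' := hmem s hs
  rw [hφα s hs'.2.2 hsα]
  have k4 := k3 s hs'.2.2.le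
  rw [← Real.dist_eq] at k4
  linarith [dist_triangle (Z α s) (Z α₀ s) (Z α₀ s₀)]

/-- The height over `0` depends continuously on the parameter. -/
lemma continuousAt_height_zero {b B m M α₀ : ℝ} {A R : ℝ → ℝ} {Z : ℝ → ℝ → ℝ} {φ : ℝ → ℝ}
    (hA : ContinuousAt A α₀) (hadm : ∀ᶠ α in 𝓝 α₀, Admissible (A α) b B (R α) m M)
    (hZ : ∀ᶠ α in 𝓝 α₀, IsProfile (A α) b B (R α) m M (Z α))
    (hφ : ∀ᶠ α in 𝓝 α₀, φ α = max (Z α 0) 0) : ContinuousAt φ α₀ := by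
  have hc : ContinuousAt (fun α => Z α 0) α₀ := Metric.tendsto_nhds.2 fun ε hε =>
    (eventually_abs_sub_lt hA hadm hZ hε).mono fun α h => h 0 le_rfl
  have hc' : ContinuousAt (fun α => max (Z α 0) 0) α₀ := hc.max continuousAt_const
  exact hc'.congr (hφ.mono fun α h => h.symm)

/-! ### The zeros of the cubic -/

/-- The position of the zeros of `f(·, α)`. -/
structure RootData (α : ℝ) : Prop where
  factor : ∀ v, f v α = (v - v1 α) * (v - v2 α) * (v - v3 α)
  v1_gt : α - 1 < v1 α
  v1_lt : v1 α < 2 * α / 3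
  lt_v2 : 2 * α / 3 < v2 α
  v2_neg : v2 α < 0
  v3_pos : 0 < v3 α
  v3_lt : v3 α < 1

lemma rootData {α : ℝ} (h : 4 * α ^ 3 < -27) : RootData α := by
  have hα : α < 0 := by
    by_contra! hα
    have := pow_nonneg hα 3
    linarith
  have hf : Continuous fun v => f v α := by unfold f; fun_prop
  have e1 : f (α - 1) α < 0 := by unfold f; nlinarith [sq_nonneg (α - 1)]
  -- The value at the critical point `2α/3` is `-4α³/27 - 1`; this is where the threshold on `α`
  -- enters.
  have e2 : 0 < f (2 * α / 3) α := by unfold f; nlinarith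
  have e3 : f 0 α < 0 := by unfold f; norm_num
  have e4 : 0 < f 1 α := by unfold f; linarith
  have hα1 : α - 1 ≤ 2 * α / 3 := by linarith
  obtain ⟨x1, hx1, h1⟩ := intermediate_value_Ioo hα1 hf.continuousOn ⟨e1, e2⟩
  obtain ⟨x2, hx2, h2⟩ := intermediate_value_Ioo' (by linarith : 2 * α / 3 ≤ 0) hf.continuousOn
    ⟨e3, e2⟩
  obtain ⟨x3, hx3, h3⟩ := intermediate_value_Ioo zero_le_one hf.continuousOn ⟨e3, e4⟩
  simp only at h1 h2 h3
  have h12 : x1 < x2 := hx1.2.trans hx2.1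
  have h23 : x2 < x3 := hx2.2.trans hx3.1
  have E12 : x1 ^ 2 + x1 * x2 + x2 ^ 2 - α * (x1 + x2) = 0 := by
    refine (mul_eq_zero.1 (?_ : (x1 - x2) * _ = 0)).resolve_left (by linarith)
    unfold f at h1 h2; linear_combination h1 - h2
  have E23 : x2 ^ 2 + x2 * x3 + x3 ^ 2 - α * (x2 + x3) = 0 := by
    refine (mul_eq_zero.1 (?_ : (x2 - x3) * _ = 0)).resolve_left (by linarith)
    unfold f at h2 h3; linear_combination h2 - h3
  have E : x1 + x2 + x3 - α = 0 := by
    refine (mul_eq_zero.1 (?_ : (x1 - x3) * _ = 0)).resolve_left (by linarith)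
    linear_combination E12 - E23
  have hfac : ∀ v, f v α = (v - x1) * (v - x2) * (v - x3) := by
    intro v
    unfold f at h1 ⊢
    have hα' : α = x1 + x2 + x3 := by linarith
    subst hα'
    linear_combination (v - x1) * E12 + h1
  have hroot : ∀ v, f v α = 0 ↔ v = x1 ∨ v = x2 ∨ v = x3 := fun v => by
    rw [hfac, mul_eq_zero, mul_eq_zero, sub_eq_zero, sub_eq_zero, sub_eq_zero, or_assoc]
  have k1 : v1 α = x1 := by
    refine IsLeast.csInf_eq ⟨h1, fun v hv => ?_⟩
    rcases (hroot v).1 hv with rfl | rfl | rfl <;> linarith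
  have k2 : v2 α = x2 := by
    refine IsLeast.csInf_eq ⟨⟨h2, by rw [k1]; exact h12⟩, fun v hv => ?_⟩
    have := hv.2
    rw [k1] at this
    rcases (hroot v).1 hv.1 with rfl | rfl | rfl <;> linarith
  have k3 : v3 α = x3 := by
    refine IsLeast.csInf_eq ⟨⟨h3, by rw [k2]; exact h23⟩, fun v hv => ?_⟩
    have := hv.2
    rw [k2] at this
    rcases (hroot v).1 hv.1 with rfl | rfl | rfl <;> linarith
  exact ⟨by rw [k1, k2, k3]; exact hfac, k1 ▸ hx1.1, k1 ▸ hx1.2, k2 ▸ hx2.1, k2 ▸ hx2.2,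
    k3 ▸ hx3.1, k3 ▸ hx3.2⟩

lemma four_mul_cube_lt {α : ℝ} (h : α < -3 / (4 : ℝ) ^ (1 / 3 : ℝ)) : 4 * α ^ 3 < -27 := by
  set t := (4 : ℝ) ^ (1 / 3 : ℝ) with ht
  have htpos : 0 < t := by positivity
  have ht3 : t ^ 3 = 4 := by
    rw [ht, ← Real.rpow_natCast, ← Real.rpow_mul (by norm_num)]; norm_num
  have h1 : α * t < -3 := (lt_div_iff₀ htpos).1 h
  have h2 : (α * t) ^ 3 < (-3) ^ 3 := Odd.strictMono_pow (by decide) h1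
  rw [mul_pow, ht3] at h2
  linarith

lemma eventually_rootData {α₀ : ℝ} (h : 4 * α₀ ^ 3 < -27) : ∀ᶠ α in 𝓝 α₀, RootData α := by
  have hc : Continuous fun α : ℝ => 4 * α ^ 3 := by fun_prop
  exact (hc.continuousAt.eventually (gt_mem_nhds h)).mono fun α hα => rootData hα

lemma f_eq_cubic (v α : ℝ) : f v α = cubic α 1 v := rfl

lemma cubic_neg (a b u : ℝ) : cubic (-a) (-b) (-u) = -cubic a b u := by
  unfold cubic; ring

namespace RootData

variable {α : ℝ}

lemma f_v1 (h : RootData α) : f (v1 α) α = 0 := by rw [h.factor]; ring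

lemma f_v2 (h : RootData α) : f (v2 α) α = 0 := by rw [h.factor]; ring

lemma f_v3 (h : RootData α) : f (v3 α) α = 0 := by rw [h.factor]; ring

lemma v1_lt_v2 (h : RootData α) : v1 α < v2 α := h.v1_lt.trans h.lt_v2

lemma v1_lt_of_f_pos (h : RootData α) {v : ℝ} (hv : 0 < f v α) : v1 α < v := by
  by_contra! hle
  rw [h.factor] at hv
  have h12 := h.v1_lt_v2
  have : 0 ≤ (v - v1 α) * (v - v2 α) :=
    mul_nonneg_of_nonpos_of_nonpos (by linarith) (by linarith)
  have := mul_nonpos_of_nonneg_of_nonpos this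
    (show v - v3 α ≤ 0 by linarith [h.v2_neg, h.v3_pos])
  linarith

lemma lt_v3_of_f_neg (h : RootData α) {v : ℝ} (hv : f v α < 0) : v < v3 α := by
  by_contra! hle
  rw [h.factor] at hv
  have h12 := h.v1_lt_v2
  have h20 := h.v2_neg
  have h30 := h.v3_pos
  have : 0 ≤ (v - v1 α) * (v - v2 α) := mul_nonneg (by linarith) (by linarith)
  have := mul_nonneg this (show 0 ≤ v - v3 α by linarith)
  linarith

lemma f_pos (h : RootData α) {v : ℝ} (h1 : v1 α < v) (h2 : v < v2 α) : 0 < f v α := by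
  rw [h.factor]
  exact mul_pos_of_neg_of_neg (mul_neg_of_pos_of_neg (by linarith) (by linarith))
    (by linarith [h.v2_neg, h.v3_pos])

lemma f_neg (h : RootData α) {v : ℝ} (h1 : 0 < v) (h2 : v < v3 α) : f v α < 0 := by
  rw [h.factor]
  exact mul_neg_of_pos_of_neg (mul_pos (by linarith [h.v1_lt_v2, h.v2_neg])
    (by linarith [h.v2_neg])) (by linarith)

end RootData

/-! ### The separatrix of the left equilibrium -/

/-- An arc from the left to the right half plane meets the vertical axis. -/
lemma exists_zero_mem_risingArc {a b : ℝ} {p q : ℝ × ℝ} (hp : p ∈ risingArc a b q)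
    (hq : q.1 ≤ 0) (hp0 : 0 ≤ p.1) : ∃ z, (0, z) ∈ risingArc a b q := by
  obtain ⟨v, z, x, y, hx, hy, ht, rfl, hs, τ, hτ, rfl⟩ := hp
  have hsub : Set.uIcc 0 τ ⊆ Set.Ioo x y := Set.ordConnected_Ioo.uIcc_subset ⟨hx, hy⟩ hτ
  obtain ⟨t, h1, h2⟩ := intermediate_value_uIcc
    (fun t h1 => (ht t (hsub h1)).1.continuousAt.continuousWithinAt :
      ContinuousOn v (Set.uIcc 0 τ)) (Set.mem_uIcc.2 (Or.inl ⟨hq, hp0⟩))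
  exact ⟨z t, v, z, x, y, hx, hy, ht, rfl, hs, t, hsub h1, by rw [h2]⟩

variable {α B m M : ℝ} {ζ : ℝ → ℝ}

lemma isProfileGraph_phiMinusGraph (hr : RootData α) (ha : Admissible α 1 B (v1 α) m M)
    (h : IsProfile α 1 B (v1 α) m M ζ) : IsProfileGraph ζ (phiMinusGraph α) where
  eq := by
    rintro p ⟨q, ⟨hqD, hqL⟩, hp⟩ hp0
    exact h.eq_of_mem_risingArc ha (K := 0) (by simp) ha.B_pos.le hqL
      (hqD.2.2.1.trans hr.v2_neg).le hp hp0
  mem := by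
    intro s₀ hs₀ hpos
    -- The base point is taken at `s ≤ -M`, where `s ζ(s) ≤ m < 2α/3 < v₂` places it in `D2`.
    have hle : min s₀ (-M) ≤ s₀ := min_le_left _ _
    have hleM : min s₀ (-M) ≤ -M := min_le_right _ _
    obtain ⟨h1, h2⟩ := h.mem_unstableSet_and_mem_risingArc ha one_ne_zero hs₀ hpos hle
    have hpos' := h.pos_of_le ha hleM
    have hs : min s₀ (-M) ≤ 0 := hle.trans hs₀
    refine ⟨_, ⟨⟨hpos', h.root_lt ha one_ne_zero hs hpos', ?_, ?_⟩, h1⟩, h2⟩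
    · have := (h.mem _ hleM).2
      simp only
      linarith [ha.slope, hr.lt_v2]
    · have := mul_pos hpos' (h.speed_pos ha one_ne_zero hs hpos')
      rw [← f_eq_cubic] at this
      simp only
      linarith

lemma isPhiMinus_iff_of_neg (hr : RootData α) (ha : Admissible α 1 B (v1 α) m M)
    (h : IsProfile α 1 B (v1 α) m M ζ) {s v z : ℝ} (hs : s < 0) (hv : v < 0)
    (hsv : s * ζ s = v) : IsPhiMinus v α z ↔ z = ζ s := by
  rw [← (isProfileGraph_phiMinusGraph hr ha h).mem_iff h ha one_ne_zero hs hv hsv, IsPhiMinus]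
  exact or_iff_left fun h0 => hv.ne h0.1

/-- If `ζ 0 > 0`, the arc crosses the axis at `s = 0`. Otherwise no arc reaches `v = 0`, the domain
is `(v₁, 0)`, and the left limit is `0`. -/
lemma isPhiMinus_zero_iff (hr : RootData α) (ha : Admissible α 1 B (v1 α) m M)
    (h : IsProfile α 1 B (v1 α) m M ζ) {z : ℝ} : IsPhiMinus 0 α z ↔ z = max (ζ 0) 0 := by
  have hG := isProfileGraph_phiMinusGraph hr ha h
  rw [IsPhiMinus, hG.mem_zero_iff]
  rcases lt_or_ge 0 (ζ 0) with h0 | h0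
  · rw [max_eq_left h0.le]
    constructor
    · rintro (h1 | ⟨-, h1, -⟩)
      · exact h1.2
      · have : (0 : ℝ) ∈ Prod.fst '' phiMinusGraph α :=
          ⟨(0, ζ 0), hG.mem_zero_iff.2 ⟨h0, rfl⟩, rfl⟩
        rw [h1] at this
        exact absurd this.2 (lt_irrefl 0)
    · exact fun h1 => Or.inl ⟨h0, h1⟩
  · rw [max_eq_right h0]
    constructor
    · rintro (h1 | ⟨-, -, φ, hφ, hlim⟩)
      · exact absurd h1.1 h0.not_gt
      · exact tendsto_nhds_unique hlim (hG.tendsto_zero h.continuous h0 ha.r_neg hφ)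
    · rintro rfl
      have hmem : ∀ w ∈ Set.Ioo (v1 α) 0, ∃ z, (w, z) ∈ phiMinusGraph α := fun w hw => by
        obtain ⟨s, hs, hsw⟩ := h.exists_mul_eq ha hw.1 hw.2
        exact ⟨_, (hG.mem_iff h ha one_ne_zero hs hw.2 hsw).2 rfl⟩
      refine Or.inr ⟨rfl, ?_, ?_⟩
      · ext w
        constructor
        · rintro ⟨p, hp, rfl⟩
          have hneg : p.1 < 0 := by
            by_contra! hp0
            obtain ⟨q, hq, hpq⟩ := hp
            obtain ⟨z, hz⟩ := exists_zero_mem_risingArc hpq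
              (hq.1.2.2.1.trans hr.v2_neg).le hp0
            exact h0.not_gt (hG.mem_zero_iff.1 ⟨q, hq, hz⟩).1
          exact ⟨hG.root_lt h ha one_ne_zero hp hneg.le, hneg⟩
        · intro hw
          obtain ⟨z, hz⟩ := hmem w hw
          exact ⟨(w, z), hz, rfl⟩
      · choose! φ hφ using hmem
        exact ⟨φ, hφ, hG.tendsto_zero h.continuous h0 ha.r_neg hφ⟩

/-! ### The separatrix of the right equilibrium -/

/-- The reflection `(v, τ) ↦ (-v, -τ)` changes the signs of the coefficients of the cubic. -/
lemma IsTrajectory.reflect {a b : ℝ} {v z : ℝ → ℝ} {I J : Set ℝ} (h : IsTrajectory a b v z I)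
    (hJ : ∀ τ ∈ J, -τ ∈ I) :
    IsTrajectory (-a) (-b) (fun τ => -v (-τ)) (fun τ => z (-τ)) J := by
  intro τ hτ
  obtain ⟨h1, h2⟩ := h (-τ) (hJ τ hτ)
  have h1' := (h1.scomp τ (hasDerivAt_neg τ)).neg
  have h2' := h2.scomp τ (hasDerivAt_neg τ)
  refine ⟨h1'.congr_deriv ?_, h2'.congr_deriv ?_⟩
  · simp only [cubic_neg, smul_eq_mul]; ring
  · simp only [cubic_neg, smul_eq_mul]; ring

lemma risingArc_reflect {a b : ℝ} {p q : ℝ × ℝ} (h : p ∈ risingArc a b q) :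
    (-p.1, p.2) ∈ risingArc (-a) (-b) (-q.1, q.2) := by
  obtain ⟨v, z, x, y, hx, hy, ht, rfl, hs, τ, hτ, rfl⟩ := h
  have hJ : ∀ t ∈ Set.Ioo (-y) (-x), -t ∈ Set.Ioo x y := fun t ht =>
    ⟨by linarith [ht.2], by linarith [ht.1]⟩
  refine ⟨_, _, -y, -x, by linarith, by linarith, ht.reflect hJ, by simp, fun t ht => ?_, -τ,
    ⟨by linarith [hτ.2], by linarith [hτ.1]⟩, by simp⟩
  have := hs (-t) (hJ t ht)
  simp only [cubic_neg]
  linarith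

lemma mem_LPlus_iff {q : ℝ × ℝ} :
    q ∈ LPlus α ↔ (-q.1, q.2) ∈ unstableSet (-α) (-1) (-v3 α) := by
  constructor
  · rintro ⟨v, z, T, ht, hz, hv, hz0, τ, hτ, rfl⟩
    have ht' : IsTrajectory α 1 v z (Set.Ioi T) := ht
    exact ⟨_, _, -T, ht'.reflect fun t (h1 : t < -T) => show T < -t by linarith,
      fun t h1 => hz (-t) (by linarith), (hv.comp tendsto_neg_atBot_atTop).neg,
      hz0.comp tendsto_neg_atBot_atTop, -τ, by linarith, by simp⟩
  · rintro ⟨v, z, T, ht, hz, hv, hz0, τ, hτ, hq⟩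
    obtain ⟨h1, h2⟩ := Prod.mk.inj hq
    have ht' := ht.reflect (J := Set.Ioi (-T)) fun t (h1 : -T < t) => show -t < T by linarith
    rw [neg_neg, neg_neg] at ht'
    have hv' := (hv.comp tendsto_neg_atTop_atBot).neg
    rw [neg_neg] at hv'
    exact ⟨_, _, -T, ht', fun t h1 => hz (-t) (by linarith), hv',
      hz0.comp tendsto_neg_atTop_atBot, -τ, by linarith, by simp [h1, h2]⟩

/-- The image of the graph of `φ⁺` under `v ↦ -v`. -/
def reflectedPhiPlusGraph (α : ℝ) : Set (ℝ × ℝ) := {p | (-p.1, p.2) ∈ phiPlusGraph α}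

/-- Base points may have `v₂ ≤ v < 0`, hence reflected abscissa up to `-v₂ > 0`. The barrier is
therefore `K = -v₂`, a zero of the reflected cubic, and `B` must exceed or equal it. -/
lemma isProfileGraph_reflectedPhiPlusGraph (hr : RootData α)
    (ha : Admissible (-α) (-1) B (-v3 α) m M) (hB : -v2 α ≤ B)
    (h : IsProfile (-α) (-1) B (-v3 α) m M ζ) :
    IsProfileGraph ζ (reflectedPhiPlusGraph α) where
  eq := by
    rintro p ⟨q, ⟨hqD, hqL⟩, hp⟩ hp0
    have hp' : p ∈ risingArc (-α) (-1) (-q.1, q.2) := by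
      have := risingArc_reflect (a := α) (b := 1) hp
      simpa using this
    refine h.eq_of_mem_risingArc ha (K := -v2 α) ?_ hB (mem_LPlus_iff.1 hqL)
      (neg_le_neg hqD.2.1) hp' hp0
    rw [cubic_neg, ← f_eq_cubic, hr.f_v2]
    simp
  mem := by
    intro s₀ hs₀ hpos
    have hb : (-1 : ℝ) ≠ 0 := by norm_num
    obtain ⟨h1, h2⟩ := h.mem_unstableSet_and_mem_risingArc ha hb hs₀ hpos le_rfl
    have hu : s₀ * ζ s₀ ≤ 0 := mul_nonpos_of_nonpos_of_nonneg hs₀ hpos.le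
    refine ⟨(-(s₀ * ζ s₀), ζ s₀), ⟨⟨hpos, ?_, ?_, ?_⟩, mem_LPlus_iff.2 ?_⟩, ?_⟩
    · simp only; linarith [hr.v2_neg]
    · have := h.root_lt ha hb hs₀ hpos
      simp only; linarith
    · have h3 := mul_pos hpos (h.speed_pos ha hb hs₀ hpos)
      have h4 := cubic_neg (-α) (-1) (s₀ * ζ s₀)
      rw [neg_neg, neg_neg, ← f_eq_cubic] at h4
      simp only
      rw [h4]
      linarith
    · simpa using h1
    · have := risingArc_reflect h2
      rw [neg_neg, neg_neg] at this
      exact this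

lemma isPhiPlus_iff {v z : ℝ} : IsPhiPlus v α z ↔ (-v, z) ∈ reflectedPhiPlusGraph α := by
  simp [IsPhiPlus, reflectedPhiPlusGraph]

lemma isPhiPlus_iff_of_pos (hr : RootData α)
    (ha : Admissible (-α) (-1) B (-v3 α) m M) (hB : -v2 α ≤ B)
    (h : IsProfile (-α) (-1) B (-v3 α) m M ζ) {s v z : ℝ} (hs : s < 0) (hv : -v < 0)
    (hsv : s * ζ s = -v) : IsPhiPlus v α z ↔ z = ζ s :=
  isPhiPlus_iff.trans
    ((isProfileGraph_reflectedPhiPlusGraph hr ha hB h).mem_iff h ha (by norm_num) hs hv hsv)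

lemma isPhiPlus_zero_iff (hr : RootData α)
    (ha : Admissible (-α) (-1) B (-v3 α) m M) (hB : -v2 α ≤ B)
    (h : IsProfile (-α) (-1) B (-v3 α) m M ζ) {z : ℝ} :
    IsPhiPlus 0 α z ↔ z = max (ζ 0) 0 := by
  have h0 := h.pos_of_neg ha (by norm_num) 0
  rw [isPhiPlus_iff, neg_zero,
    (isProfileGraph_reflectedPhiPlusGraph hr ha hB h).mem_zero_iff, max_eq_left h0.le]
  exact and_iff_right h0

/-! ### Uniform choice of the constants -/

/-- One `m`, `M` and `B` serve all nearby `α`. Continuity of `v1` is not needed: `f m α > 0`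
persists and forces `v1 α < m`, while `v1 α > α - 1` gives the bound by `B`. -/
lemma eventually_admissible_minus {α₀ : ℝ} (h₀ : RootData α₀) {m : ℝ} (hm1 : v1 α₀ < m)
    (hm2 : 3 * m < 2 * α₀) (hm : m < 0) :
    ∃ M, ∀ᶠ α in 𝓝 α₀, Admissible α 1 (|α₀| + 3) (v1 α) m M := by
  have hf : 0 < f m α₀ := h₀.f_pos hm1 (by linarith [h₀.lt_v2])
  obtain ⟨M, hM, hlarge⟩ : ∃ M, 0 < M ∧ -m < M ^ 2 * f m α₀ := by
    have : Tendsto (fun M : ℝ => M ^ 2 * f m α₀) atTop atTop :=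
      (tendsto_pow_atTop two_ne_zero).atTop_mul_const hf
    obtain ⟨M, h1, h2⟩ := ((eventually_gt_atTop 0).and (this.eventually_gt_atTop (-m))).exists
    exact ⟨M, h1, h2⟩
  have hc : Continuous fun α => f m α := by unfold f; fun_prop
  have hroot : 4 * α₀ ^ 3 < -27 := by
    have := h₀.f_pos h₀.v1_lt h₀.lt_v2
    unfold f at this
    nlinarith
  refine ⟨M, ?_⟩
  filter_upwards [eventually_rootData hroot, lt_mem_nhds (show 3 * m / 2 < α₀ by linarith),
    hc.continuousAt.eventually (lt_mem_nhds hf),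
    (hc.const_mul (M ^ 2)).continuousAt.eventually (lt_mem_nhds hlarge),
    Metric.ball_mem_nhds α₀ one_pos] with α k1 k2 k3 k4 k5
  refine ⟨k1.f_v1, k1.v1_lt_of_f_pos k3, hm, by linarith, ?_, hM, k4⟩
  rw [Metric.mem_ball, Real.dist_eq, abs_lt] at k5
  linarith [k1.v1_gt, neg_abs_le α₀]

lemma eventually_admissible_plus {α₀ : ℝ} (h₀ : RootData α₀) {m : ℝ} (hm1 : -v3 α₀ < m)
    (hm : m < 0) :
    ∃ M, ∀ᶠ α in 𝓝 α₀, Admissible (-α) (-1) (|α₀| + 3) (-v3 α) m M ∧ -v2 α ≤ |α₀| + 3 := by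
  have hf : f (-m) α₀ < 0 := h₀.f_neg (by linarith) (by linarith)
  obtain ⟨M, hM, hlarge⟩ : ∃ M, 0 < M ∧ -m < M ^ 2 * -f (-m) α₀ := by
    have : Tendsto (fun M : ℝ => M ^ 2 * -f (-m) α₀) atTop atTop :=
      (tendsto_pow_atTop two_ne_zero).atTop_mul_const (neg_pos.2 hf)
    obtain ⟨M, h1, h2⟩ := ((eventually_gt_atTop 0).and (this.eventually_gt_atTop (-m))).exists
    exact ⟨M, h1, h2⟩
  have hc : Continuous fun α => f (-m) α := by unfold f; fun_prop
  have hroot : 4 * α₀ ^ 3 < -27 := by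
    have := h₀.f_pos h₀.v1_lt h₀.lt_v2
    unfold f at this
    nlinarith
  have hα₀ : α₀ < 0 := by linarith [h₀.lt_v2, h₀.v2_neg]
  refine ⟨M, ?_⟩
  filter_upwards [eventually_rootData hroot, gt_mem_nhds hα₀,
    hc.continuousAt.eventually (gt_mem_nhds hf),
    (hc.neg.const_mul (M ^ 2)).continuousAt.eventually (lt_mem_nhds hlarge),
    Metric.ball_mem_nhds α₀ one_pos] with α k1 k2 k3 k4 k5
  have hneg : ∀ u, cubic (-α) (-1) u = -f (-u) α := fun u => by unfold cubic f; ring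
  rw [Metric.mem_ball, Real.dist_eq, abs_lt] at k5
  refine ⟨⟨?_, ?_, hm, by linarith, ?_, hM, by rw [hneg]; exact k4⟩, ?_⟩
  · rw [hneg, neg_neg, k1.f_v3, neg_zero]
  · linarith [k1.lt_v3_of_f_neg k3]
  · linarith [k1.v3_lt, abs_nonneg α₀]
  · linarith [k1.v1_gt, k1.v1_lt_v2, neg_abs_le α₀]

/-! ### Assembly of well-definedness and continuity -/

lemma epsilon_eq_of_forall_iff {P : ℝ → Prop} {c : ℝ} (h : ∀ z, P z ↔ z = c) :
    Classical.epsilon P = c :=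
  (h _).1 (Classical.epsilon_spec ⟨c, (h c).2 rfl⟩)

lemma existsUnique_of_forall_iff {P : ℝ → Prop} {c : ℝ} (h : ∀ z, P z ↔ z = c) : ∃! z, P z :=
  ⟨c, (h c).2 rfl, fun z hz => (h z).1 hz⟩

lemma exists_profile_family {b B m M α₀ : ℝ} {A R : ℝ → ℝ}
    (hadm : ∀ᶠ α in 𝓝 α₀, Admissible (A α) b B (R α) m M) :
    ∃ Z : ℝ → ℝ → ℝ, ∀ᶠ α in 𝓝 α₀, IsProfile (A α) b B (R α) m M (Z α) := by
  have : ∀ α, ∃ ζ, Admissible (A α) b B (R α) m M → IsProfile (A α) b B (R α) m M ζ := fun α => by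
    by_cases h : Admissible (A α) b B (R α) m M
    · exact h.exists_isProfile.imp fun ζ hζ _ => hζ
    · exact ⟨0, fun h' => absurd h' h⟩
  choose Z hZ using this
  exact ⟨Z, hadm.mono fun α h => hZ α h⟩

theorem phiMinus_wellDefined_continuousAt {α₀ v₀ : ℝ} (hα₀ : 4 * α₀ ^ 3 < -27)
    (hv₀ : v₀ ∈ Set.Ioc (v1 α₀) 0) :
    (∀ᶠ α in 𝓝 α₀, ∃! z, IsPhiMinus v₀ α z) ∧ ContinuousAt (fun α => phiMinus v₀ α) α₀ := by
  have h₀ := rootData hα₀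
  -- Taking `m` below `v₀` as well yields `v1 α < m < v₀` for all nearby `α`, so `v₀` stays in the
  -- range of `s ζ(s)`, or is `0`.
  obtain ⟨m, hm1, hm2⟩ := exists_between (lt_min h₀.v1_lt hv₀.1)
  have hm3 := hm2.trans_le (min_le_left _ _)
  have hm4 := hm2.trans_le (min_le_right _ _)
  have hm : m < 0 := hm4.trans_le hv₀.2
  obtain ⟨M, hadm⟩ := eventually_admissible_minus h₀ hm1 (by linarith) hm
  obtain ⟨Z, hZ⟩ := exists_profile_family (A := id) hadm
  have hr := eventually_rootData hα₀
  rcases hv₀.2.eq_or_lt with rfl | hneg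
  · have key : ∀ᶠ α in 𝓝 α₀, ∀ z, IsPhiMinus 0 α z ↔ z = max (Z α 0) 0 := by
      filter_upwards [hr, hadm, hZ] with α k1 k2 k3 z
      exact isPhiMinus_zero_iff k1 k2 k3
    exact ⟨key.mono fun α h => existsUnique_of_forall_iff h,
      continuousAt_height_zero (A := id) continuousAt_id hadm hZ
        (key.mono fun α h => epsilon_eq_of_forall_iff h)⟩
  · have key : ∀ᶠ α in 𝓝 α₀, ∀ s < 0, s * Z α s = v₀ → ∀ z, IsPhiMinus v₀ α z ↔ z = Z α s := by
      filter_upwards [hr, hadm, hZ] with α k1 k2 k3 s hs hsv z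
      exact isPhiMinus_iff_of_neg k1 k2 k3 hs hneg hsv
    refine ⟨?_, continuousAt_height (A := id) one_ne_zero continuousAt_id hadm hZ hv₀.1 hneg
      (key.mono fun α h s hs hsv => epsilon_eq_of_forall_iff (h s hs hsv))⟩
    filter_upwards [key, hadm, hZ] with α k1 k2 k3
    obtain ⟨s, hs, hsv⟩ := k3.exists_mul_eq k2 (k2.lt.trans hm4) hneg
    exact existsUnique_of_forall_iff (k1 s hs hsv)

theorem phiPlus_wellDefined_continuousAt {α₀ v₀ : ℝ} (hα₀ : 4 * α₀ ^ 3 < -27)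
    (hv₀ : v₀ ∈ Set.Ico 0 (v3 α₀)) :
    (∀ᶠ α in 𝓝 α₀, ∃! z, IsPhiPlus v₀ α z) ∧ ContinuousAt (fun α => phiPlus v₀ α) α₀ := by
  have h₀ := rootData hα₀
  obtain ⟨m, hm1, hm4⟩ := exists_between (neg_lt_neg hv₀.2)
  have hm : m < 0 := hm4.trans_le (by linarith [hv₀.1])
  obtain ⟨M, hadm'⟩ := eventually_admissible_plus h₀ hm1 hm
  have hadm := hadm'.mono fun α h => h.1
  obtain ⟨Z, hZ⟩ := exists_profile_family (A := fun α => -α) (R := fun α => -v3 α) hadm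
  have hr := eventually_rootData hα₀
  rcases hv₀.1.eq_or_lt with rfl | hpos
  · have key : ∀ᶠ α in 𝓝 α₀, ∀ z, IsPhiPlus 0 α z ↔ z = max (Z α 0) 0 := by
      filter_upwards [hr, hadm', hZ] with α k1 k2 k3 z
      exact isPhiPlus_zero_iff k1 k2.1 k2.2 k3
    exact ⟨key.mono fun α h => existsUnique_of_forall_iff h,
      continuousAt_height_zero continuous_neg.continuousAt hadm hZ
        (key.mono fun α h => epsilon_eq_of_forall_iff h)⟩
  · have hneg : -v₀ < 0 := by linarith
    have key : ∀ᶠ α in 𝓝 α₀, ∀ s < 0, s * Z α s = -v₀ → ∀ z, IsPhiPlus v₀ α z ↔ z = Z α s := by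
      filter_upwards [hr, hadm', hZ] with α k1 k2 k3 s hs hsv z
      exact isPhiPlus_iff_of_pos k1 k2.1 k2.2 k3 hs hneg hsv
    refine ⟨?_, continuousAt_height (by norm_num) continuous_neg.continuousAt hadm hZ
      (neg_lt_neg hv₀.2) hneg
      (key.mono fun α h s hs hsv => epsilon_eq_of_forall_iff (h s hs hsv))⟩
    filter_upwards [key, hadm, hZ] with α k1 k2 k3
    obtain ⟨s, hs, hsv⟩ := k3.exists_mul_eq k2 (k2.lt.trans hm4) hneg
    exact existsUnique_of_forall_iff (k1 s hs hsv)

end PolySys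

theorem mainTheorem8 (α₀ : ℝ) (hα₀ : α₀ < -3 / (4 : ℝ) ^ (1 / 3 : ℝ)) :
    (∀ v₀ ∈ Set.Ioc (PolySys.v1 α₀) 0,
      (∀ᶠ α in 𝓝 α₀, ∃! z, PolySys.IsPhiMinus v₀ α z) ∧
        ContinuousAt (fun α => PolySys.phiMinus v₀ α) α₀) ∧
    (∀ v₀ ∈ Set.Ico 0 (PolySys.v3 α₀),
      (∀ᶠ α in 𝓝 α₀, ∃! z, PolySys.IsPhiPlus v₀ α z) ∧
        ContinuousAt (fun α => PolySys.phiPlus v₀ α) α₀) :=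
  ⟨fun _ hv₀ => PolySys.phiMinus_wellDefined_continuousAt (PolySys.four_mul_cube_lt hα₀) hv₀,
    fun _ hv₀ => PolySys.phiPlus_wellDefined_continuousAt (PolySys.four_mul_cube_lt hα₀) hv₀⟩
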